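/- \textbf{Conventions.} $\mathcal O$ is Kleene's set of ordinal notations with order $<_{\mathcal O}$; $0$ is the notation for the ordinal zero, $\beta+1$ is the successor notation of $\beta$. Reals are elements of $\omega^\omega$, strings are elements of $\omega^{<\omega}$, trees are sets of strings closed under initial segments, $[T]$ is the set of infinite paths through $T$, and $\oplus$ is the join of reals. For $\beta\in\mathcal O$ the real $X^{(\beta)}$ is the $\beta$-th jump of $X$ along the notation $\beta$, coded so that $X^{(\gamma)}$ is a part of $X^{(\beta)}$ for $\gamma\le_{\mathcal O}\beta$ and $\beta$ is computable from $X^{(\beta)}$. A \emph{path in} $\mathcal O$ is a downward closed, linearly ordered subset of $\mathcal O$; it is a \emph{path through} $\mathcal O$ if it has height $\omega_1^{CK}$. A partial function $\Gamma$ on strings with downward closed domain is \emph{expansionary} if $\sigma\subsetneq\tau\iff\Gamma(\sigma)\subsetneq\Gamma(\tau)$ on its domain and $\Gamma$ preserves the left-of relation and longest common initial segments. \textbf{Towers.} A \emph{tower} consists of a non-empty path $I$ in $\mathcal O$, trees $T_\beta$ ($\beta\in I$) and expansionary functions $\Gamma^\gamma_\beta$ with domain $T_\gamma$ and values in $T_\beta$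 ($\beta\le_{\mathcal O}\gamma\in I$) such that $T_\beta$ is computable from $0^{(\beta)}$ uniformly in $\beta$; $\Gamma^\gamma_\beta$ is computable from $0^{(\gamma)}$ uniformly in $\gamma,\beta$; $\Gamma^\gamma_\gamma$ is the identity of $T_\gamma$; $\Gamma^\gamma_\beta$ induces a homeomorphism of $[T_\gamma]$ with $[T_\beta]$; and $\Gamma^\gamma_\beta=\Gamma^{\gamma'}_\beta\circ\Gamma^\gamma_{\gamma'}$ for $\beta<_{\mathcal O}\gamma'<_{\mathcal O}\gamma$. Its \emph{root} is $T_0$. It has height $\alpha\in\mathcal O$ if $I=\{\beta:\beta\le_{\mathcal O}\alpha\}$, height at least $\kappa\in\mathcal O$ if $\kappa\in I$, height greater than $\kappa$ if moreover $\kappa$ is not the largest element of $I$, and height $\omega_1^{CK}$ if $I$ is a path through $\mathcal O$. For $g\in[T_0]$ let $g^\beta$ be the path through $T_\beta$ that $\Gamma^\beta_0$ sends to $g$. Let $I^-$ be the set of non-maximal elements of $I$. For a functional $\Theta$, let $\Theta(\tau)$ be the longest string of length at most $|\tau|$ whose entries are computed from $\tau$ in at most $|\tau|$ steps. A set $S$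 of strings is \emph{$\Theta$-splitting over} $f$ if every initial segment of $f$ has extensions $\tau_0,\tau_1\in S$ such that $\Theta(\tau_0)$ and $\Theta(\tau_1)$ are incompatible. The tower is \emph{subgeneric} if: (1) $(0^{(\beta)}\oplus g^\beta)'\le_T 0^{(\beta+1)}\oplus g^{\beta+1}$ for $\beta\in I^-$, $g\in[T_0]$, uniformly in $\beta$ and $g$; (2) $g^\beta\not\le_T 0^{(\beta)}$ for $\beta\in I^-$, $g\in[T_0]$; (3) $g^\beta\ne h^\beta$ implies $g^\beta\not\le_T 0^{(\beta)}\oplus h^\beta$, for $\beta\in I^-$, $g,h\in[T_0]$; (4) for $\beta<_{\mathcal O}\lambda\in I^-$, every $0^{(\beta)}$-computable functional $\Theta$ and every $f\in[T_\beta]$: if the image of $T_\alpha$ under $\Gamma^\alpha_\beta$ is $\Theta$-splitting over $f$ for all $\alpha$ with $\beta\le_{\mathcal O}\alpha<_{\mathcal O}\lambda$, then so is the image of $T_\lambda$ under $\Gamma^\lambda_\beta$; (5) for $\beta\in I^-$ and every set $W$ of strings that is r.e. in $0^{(\beta)}$, each $f\in[T_\beta]$ has an initial segment $\sigma$ such that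 $\sigma\in W$ or no $\tau\supseteq\sigma$ is in $W\cap T_\beta$. \textbf{Subgenericity.} A real $g$ is \emph{$\alpha$-subgeneric} ($\alpha\in\mathcal O$) if for all $\beta'<_{\mathcal O}\beta\le_{\mathcal O}\alpha$: (i) $g^{(\beta)}\equiv_T 0^{(\beta)}\oplus g$; (ii) the degree of $0^{(\beta')}$ is the greatest lower bound of the degrees of $g^{(\beta')}$ and $0^{(\beta)}$; (iii) $g\not\le_T 0^{(\beta')}$. A class $\mathcal C$ of reals is \emph{uniformly $\alpha$-subgeneric} if there is a computable functional $\Gamma$ such that every $g\in\mathcal C$ is $\alpha$-subgeneric, $\Gamma(0^{(\beta)};g)=g^{(\beta)}$ for all $g\in\mathcal C$ and $\beta\le_{\mathcal O}\alpha$, and $f\not\le_T g^{(\beta)}$ whenever $f\ne g$ are in $\mathcal C$ and $\beta<_{\mathcal O}\alpha$. It is \emph{uniformly $\omega_1^{CK}$-subgeneric} if this holds, with one $\Gamma$, for all $\alpha$ in some path through $\mathcal O$. \textbf{Lemma.} Let $T_0$ be the root of a subgeneric tower with index path $I$. (a) If the tower has height at least $\kappa\in\mathcal O$, then $[T_0]$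 is uniformly $\kappa$-subgeneric, where, if $\kappa$ is exactly the height of the tower, clause (ii) is claimed only for $\beta<_{\mathcal O}\kappa$, and not for $\beta=\kappa$. In particular, $[T_0]$ is uniformly $\kappa$-subgeneric with no exception if the height of the tower is greater than $\kappa$. (b) If the tower has height $\omega_1^{CK}$, then $[T_0]$ is uniformly $\omega_1^{CK}$-subgeneric, as witnessed by the path $I$. -/

import Mathlib

open Nat.Partrec (Code)

/-! ### Strings, reals and trees -/

/-- The initial segment of length `n` of a real `f`. -/
def restr (f : ℕ → ℕ) (n : ℕ) : List ℕ := (List.range n).map f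

/-- Trees are sets of strings closed under initial segments. -/
def IsTree (T : Set (List ℕ)) : Prop := ∀ σ τ, σ <+: τ → τ ∈ T → σ ∈ T

/-- `[T]`, the set of infinite paths through a tree `T`. -/
def treePaths (T : Set (List ℕ)) : Set (ℕ → ℕ) := {f | ∀ n, restr f n ∈ T}

/-- The string `σ` is an initial segment of the real `f`. -/
def InitSeg (σ : List ℕ) (f : ℕ → ℕ) : Prop := restr f σ.length = σ

/-- Strict extension of strings: `τ` properly extends `σ`. -/
def StrictPrefix (σ τ : List ℕ) : Prop := σ <+: τ ∧ σ ≠ τ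

/-- Incompatibility of strings. -/
def Incompat (σ τ : List ℕ) : Prop := ¬ σ <+: τ ∧ ¬ τ <+: σ

/-- `σ` is to the left of `τ`: at the first place where they disagree (which lies below both
lengths) `σ` has the smaller entry. -/
def LeftOf (σ τ : List ℕ) : Prop :=
  ∃ ρ : List ℕ, ∃ x y : ℕ, x < y ∧ ρ ++ [x] <+: σ ∧ ρ ++ [y] <+: τ

/-- The longest common initial segment of two strings. -/
def strMeet : List ℕ → List ℕ → List ℕ
  | a :: σ, b :: τ => if a = b then a :: strMeet σ τ else []
  | _, _ => []

/-- `Γ` is an expansionary function on the strings in the (downward closed) domain `D`: it is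
monotone for proper extension in both directions, and it respects left-of and longest common
initial segments. -/
structure Expansionary (D : Set (List ℕ)) (Γ : List ℕ → List ℕ) : Prop where
  monotone : ∀ σ ∈ D, ∀ τ ∈ D, StrictPrefix σ τ ↔ StrictPrefix (Γ σ) (Γ τ)
  leftOf : ∀ σ ∈ D, ∀ τ ∈ D, LeftOf σ τ → LeftOf (Γ σ) (Γ τ)
  meet : ∀ σ ∈ D, ∀ τ ∈ D, Γ (strMeet σ τ) = strMeet (Γ σ) (Γ τ)

/-- The functional on reals that is induced by the function `Γ` on strings sends `f` to `g`. -/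
def SendsPath (Γ : List ℕ → List ℕ) (f g : ℕ → ℕ) : Prop := ∀ n, InitSeg (Γ (restr f n)) g

/-! ### Computable functionals, Turing reducibility and the jump -/

/-- The computable functional with index `c`, in Kleene's normal form. The machine `c` is run on
longer and longer initial segments of the oracle `X`, until it answers with a nonzero value
`y + 1`; the output is then `y`. -/
def functional (c : Code) (X : ℕ → ℕ) (n : ℕ) : Part ℕ :=
  (Nat.rfind fun k =>
      (c.eval (Nat.pair (Encodable.encode (restr X k)) n)).map fun v => decide (v ≠ 0)).bind
    fun k => (c.eval (Nat.pair (Encodable.encode (restr X k)) n)).map Nat.pred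

/-- The join `f ⊕ g` of two reals. -/
def join (f g : ℕ → ℕ) (n : ℕ) : ℕ := if n % 2 = 0 then f (n / 2) else g (n / 2)

/-- Turing reducibility of reals: `f` is computable from `g`. -/
def TRed (f g : ℕ → ℕ) : Prop := TuringReducible (f : ℕ →. ℕ) (g : ℕ →. ℕ)

/-- Turing equivalence of reals. -/
def TEquiv (f g : ℕ → ℕ) : Prop := TRed f g ∧ TRed g f

/-- A set of strings that is recursively enumerable in the real `A`. -/
def REIn (A : ℕ → ℕ) (W : Set (List ℕ)) : Prop :=
  ∃ p : List ℕ →. ℕ, RecursiveIn {(A : ℕ →. ℕ)} p ∧ ∀ σ, σ ∈ W ↔ (p σ).Dom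

open Classical in
/-- The Turing jump: the characteristic function of the halting problem relative to `X`. -/
noncomputable def turingJump (X : ℕ → ℕ) (e : ℕ) : ℕ :=
  if (functional (Denumerable.ofNat Code e) X e).Dom then 1 else 0

/-! ### Kleene's ordinal notations

The number `0` denotes the ordinal zero, `2 * a + 1` is the successor of `a`, and `2 * e + 2`
denotes the limit of the sequence computed by the machine with index `e`. -/

/-- The successor notation `a + 1`. -/
def succNote (a : ℕ) : ℕ := 2 * a + 1

/-- The notation for the limit of the sequence with index `e`. -/
def limNote (e : ℕ) : ℕ := 2 * e + 2

/-- The notation `a` is the predecessor of `b`, or a member of the sequence with limit `b`. -/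
inductive NoteStep : ℕ → ℕ → Prop
  | succ (a : ℕ) : NoteStep a (succNote a)
  | lim (e n a : ℕ) : a ∈ (Denumerable.ofNat Code e).eval n → NoteStep a (limNote e)

/-- Kleene's `𝒪`. -/
inductive KleeneO : ℕ → Prop
  | zero : KleeneO 0
  | succ (a : ℕ) : KleeneO a → KleeneO (succNote a)
  | lim (e : ℕ) (s : ℕ → ℕ) :
      (∀ n, s n ∈ (Denumerable.ofNat Code e).eval n) →
      (∀ n, KleeneO (s n)) →
      (∀ n, Relation.TransGen NoteStep (s n) (s (n + 1))) →
      KleeneO (limNote e)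

/-- The strict order of Kleene's `𝒪`. -/
def OLt (a b : ℕ) : Prop := KleeneO b ∧ Relation.TransGen NoteStep a b

/-- The non-strict order of Kleene's `𝒪`. -/
def OLe (a b : ℕ) : Prop := KleeneO b ∧ (a = b ∨ Relation.TransGen NoteStep a b)

theorem noteStep_cases {a b : ℕ} (h : NoteStep a b) :
    b = succNote a ∨ ∃ e n, b = limNote e ∧ a ∈ (Denumerable.ofNat Code e).eval n := by
  cases h with
  | succ => exact Or.inl rfl
  | lim e n _ h => exact Or.inr ⟨e, n, rfl, h⟩

theorem acc_transGen_noteStep {b : ℕ} (hb : KleeneO b) :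
    Acc (Relation.TransGen NoteStep) b := by
  apply Acc.transGen
  induction hb with
  | zero =>
    refine ⟨_, fun a h => ?_⟩
    rcases noteStep_cases h with h | ⟨e, n, h, -⟩ <;> simp [succNote, limNote] at h
  | succ a _ ih =>
    refine ⟨_, fun c h => ?_⟩
    rcases noteStep_cases h with h | ⟨e, n, h, -⟩
    · have : c = a := by simp only [succNote] at h; omega
      exact this ▸ ih
    · simp only [succNote, limNote] at h; omega
  | lim e s hs _ _ ih =>
    refine ⟨_, fun c h => ?_⟩
    rcases noteStep_cases h with h | ⟨e', n, h, hc⟩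
    · simp only [succNote, limNote] at h; omega
    · have : e' = e := by simp only [limNote] at h; omega
      subst this
      exact Part.mem_unique (hs n) hc ▸ ih n

theorem OLt.wellFounded : WellFounded OLt := by
  refine ⟨fun b => ⟨_, fun a h => ?_⟩⟩
  have hacc := (acc_transGen_noteStep h.1).inv h.2
  clear h
  induction hacc with
  | intro x _ ih => exact ⟨_, fun y hy => ih y hy.2⟩

instance : IsWellFounded ℕ OLt := ⟨OLt.wellFounded⟩

/-- The ordinal denoted by a notation. -/
noncomputable def noteHeight (a : ℕ) : Ordinal.{0} := IsWellFounded.rank OLt a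

/-- A path in `𝒪`: a linearly ordered, downward closed set of notations. -/
structure IsPathInO (I : Set ℕ) : Prop where
  subset : ∀ a ∈ I, KleeneO a
  downward : ∀ b ∈ I, ∀ a, OLt a b → a ∈ I
  linear : ∀ a ∈ I, ∀ b ∈ I, a = b ∨ OLt a b ∨ OLt b a

/-- A path through `𝒪`: a path in `𝒪` of full height, that is, one which has a notation for every
ordinal that has a notation at all. -/
def IsPathThroughO (I : Set ℕ) : Prop :=
  IsPathInO I ∧ ∀ a, KleeneO a → ∃ b ∈ I, noteHeight b = noteHeight a

/-! ### Transfinite jumps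

The jump `X^(β)` is made of one column for each `γ ≤ β`: the column at `0` is `X`, the one at a
successor `γ + 1` is the jump of `X^(γ)`, and limits add only an empty column. An entry `y` of an
existing column is stored as `y + 1`, and the value `0` marks the missing columns. So `X^(β)` is
the restriction of `X^(α)` to the columns below `β` whenever `β ≤ α`, at a limit it is the union
of the earlier jumps, and `β` can be computed from `X^(β)`. -/

theorem OLe.olt_succNote {d k : ℕ} (h : OLe d k) : OLt d (succNote k) := by
  refine ⟨KleeneO.succ k h.1, ?_⟩
  rcases h.2 with rfl | h
  · exact Relation.TransGen.single (NoteStep.succ _)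
  · exact Relation.TransGen.tail h (NoteStep.succ _)

open Classical in
/-- The column with index `γ` of the transfinite jumps of `X`. -/
noncomputable def jumpColumn (X : ℕ → ℕ) : ℕ → ℕ → ℕ :=
  OLt.wellFounded.fix fun γ column =>
    if γ = 0 then X
    else if hγ : ∃ k, γ = succNote k then
      turingJump fun p =>
        if h : OLe p.unpair.1 hγ.choose then
          column p.unpair.1 (hγ.choose_spec.symm ▸ h.olt_succNote) p.unpair.2 + 1
        else 0
    else fun _ => 0

open Classical in
/-- The jump `X^(β)`. -/
noncomputable def jumpIter (X : ℕ → ℕ) (β : ℕ) (p : ℕ) : ℕ :=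
  if OLe p.unpair.1 β then jumpColumn X p.unpair.1 p.unpair.2 + 1 else 0

theorem jumpColumn_zero (X : ℕ → ℕ) : jumpColumn X 0 = X := by
  rw [jumpColumn, WellFounded.fix_eq, if_pos rfl]

theorem jumpColumn_succNote (X : ℕ → ℕ) (k : ℕ) :
    jumpColumn X (succNote k) = turingJump (jumpIter X k) := by
  have hγ : ∃ k', succNote k = succNote k' := ⟨k, rfl⟩
  have hk : hγ.choose = k := by
    have h : succNote k = succNote hγ.choose := hγ.choose_spec
    generalize hγ.choose = m at h
    simp only [succNote] at h
    omega
  rw [jumpColumn, WellFounded.fix_eq, if_neg (by simp [succNote]), dif_pos hγ]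
  congr 1
  funext p
  by_cases h : OLe p.unpair.1 k
  · rw [jumpIter, if_pos h, dif_pos (hk.symm ▸ h)]
    rfl
  · rw [jumpIter, if_neg h, dif_neg (hk.symm ▸ h)]

theorem jumpColumn_limNote (X : ℕ → ℕ) (e : ℕ) : jumpColumn X (limNote e) = fun _ => 0 := by
  rw [jumpColumn, WellFounded.fix_eq, if_neg (by simp [limNote]), dif_neg]
  rintro ⟨k, hk⟩
  simp only [limNote, succNote] at hk
  omega

/-- The real `0^(β)`. -/
noncomputable def zeroJump (β : ℕ) : ℕ → ℕ := jumpIter (fun _ => 0) β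

/-! ### Subgeneric reals and classes -/

/-- The degree of `g^(β)` is the join of the degrees of `0^(β)` and `g`. -/
def JumpClause (g : ℕ → ℕ) (β : ℕ) : Prop := TEquiv (jumpIter g β) (join (zeroJump β) g)

/-- The degree of `0^(β')` is the greatest lower bound of the degrees of `g^(β')` and `0^(β)`. -/
def MeetClause (g : ℕ → ℕ) (β' β : ℕ) : Prop :=
  TRed (zeroJump β') (jumpIter g β') ∧ TRed (zeroJump β') (zeroJump β) ∧
    ∀ X : ℕ → ℕ, TRed X (jumpIter g β') → TRed X (zeroJump β) → TRed X (zeroJump β')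

/-- The real `g` is `α`-subgeneric. -/
def Subgeneric (α : ℕ) (g : ℕ → ℕ) : Prop :=
  ∀ β' β, OLt β' β → OLe β α →
    JumpClause g β ∧ MeetClause g β' β ∧ ¬ TRed g (zeroJump β')

/-- All clauses of `α`-subgenericity, except for the meet clause at the top level `β = α`. -/
def SubgenericOffTop (α : ℕ) (g : ℕ → ℕ) : Prop :=
  ∀ β' β, OLt β' β → OLe β α →
    JumpClause g β ∧ (β ≠ α → MeetClause g β' β) ∧ ¬ TRed g (zeroJump β')

/-- Every member of `C` satisfies `S α`, the functional with index `c` uniformly computes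
`g^(β)` from `0^(β)` and `g` for `g ∈ C` and `β ≤ α`, and no member of `C` is computable from the
`β`-th jump of another one for `β < α`. -/
structure UniformlyVia (S : ℕ → (ℕ → ℕ) → Prop) (c : Code) (α : ℕ) (C : Set (ℕ → ℕ)) :
    Prop where
  members : ∀ g ∈ C, S α g
  uniform : ∀ g ∈ C, ∀ β, OLe β α →
    ∀ n, functional c (join (zeroJump β) g) n = Part.some (jumpIter g β n)
  incomparable : ∀ f ∈ C, ∀ g ∈ C, ∀ β, OLt β α → f ≠ g → ¬ TRed f (jumpIter g β)

/-- The class `C` is uniformly `α`-subgeneric. -/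
def UniformlySubgeneric (α : ℕ) (C : Set (ℕ → ℕ)) : Prop :=
  ∃ c, UniformlyVia Subgeneric c α C

/-- The class `C` is uniformly `α`-subgeneric but for the meet clause at the top level `α`. -/
def UniformlySubgenericOffTop (α : ℕ) (C : Set (ℕ → ℕ)) : Prop :=
  ∃ c, UniformlyVia SubgenericOffTop c α C

/-- The class `C` is uniformly `α`-subgeneric for all `α` on the path `P`, with one functional. -/
def UniformlySubgenericAlong (P : Set ℕ) (C : Set (ℕ → ℕ)) : Prop :=
  ∃ c, ∀ α ∈ P, UniformlyVia Subgeneric c α C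

/-- The class `C` is uniformly `ω₁^CK`-subgeneric. -/
def UniformlyCKSubgeneric (C : Set (ℕ → ℕ)) : Prop :=
  ∃ P, IsPathThroughO P ∧ UniformlySubgenericAlong P C

/-! ### Splitting -/

/-- The bounded value of the functional `f ↦ functional c (A ⊕ f)` on a string `σ`: the
computation of the `n`-th output gives `y` within `|σ|` steps, looking only at the part of `A ⊕ f`
that is determined by `σ` when `f` extends `σ`. -/
def StringValue (c : Code) (A : ℕ → ℕ) (σ : List ℕ) (n y : ℕ) : Prop :=
  ∃ k ≤ 2 * σ.length,
    Code.evaln σ.length c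
        (Nat.pair (Encodable.encode (restr (join A fun i => σ.getD i 0) k)) n) = some (y + 1) ∧
      ∀ j < k, Code.evaln σ.length c
        (Nat.pair (Encodable.encode (restr (join A fun i => σ.getD i 0) j)) n) = some 0

/-- The function on strings that is given by the `A`-computable functional with index `c` sends
`σ` to `τ`: `τ` is the longest string of length at most `|σ|` all of whose entries are bounded
values of the functional on `σ`. -/
def StringImage (c : Code) (A : ℕ → ℕ) (σ τ : List ℕ) : Prop :=
  τ.length ≤ σ.length ∧
    (∀ (n : ℕ) (h : n < τ.length), StringValue c A σ n τ[n]) ∧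
    (τ.length < σ.length → ∀ y, ¬ StringValue c A σ τ.length y)

/-- The set of strings `S` is splitting over the real `f`, for the `A`-computable functional with
index `c`. -/
def SplittingOver (c : Code) (A : ℕ → ℕ) (S : Set (List ℕ)) (f : ℕ → ℕ) : Prop :=
  ∀ n, ∃ τ₀ ∈ S, ∃ τ₁ ∈ S, restr f n <+: τ₀ ∧ restr f n <+: τ₁ ∧
    ∃ ρ₀ ρ₁, StringImage c A τ₀ ρ₀ ∧ StringImage c A τ₁ ρ₁ ∧ Incompat ρ₀ ρ₁

/-! ### Towers of trees -/

/-- A tower of trees: a non-empty path `I` in `𝒪`, trees `T β` for `β ∈ I`, and expansionary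
functions `Γ γ β` from `T γ` to `T β` for `β ≤ γ` in `I` (values at other arguments do not
matter). -/
structure TreeTower where
  I : Set ℕ
  T : ℕ → Set (List ℕ)
  Γ : ℕ → ℕ → List ℕ → List ℕ
  path : IsPathInO I
  nonempty : I.Nonempty
  tree : ∀ β ∈ I, IsTree (T β)
  /-- `T β` is computable from `0^(β)`, uniformly in `β`. -/
  tree_computable : ∃ c : Code, ∀ β ∈ I, ∀ σ : List ℕ, ∃ v : ℕ,
    functional c (zeroJump β) (Nat.pair β (Encodable.encode σ)) = Part.some v ∧
      (v = 1 ∧ σ ∈ T β ∨ v = 0 ∧ σ ∉ T β)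
  /-- `Γ γ β` is computable from `0^(γ)`, uniformly in `γ` and `β`. -/
  map_computable : ∃ c : Code, ∀ γ ∈ I, ∀ β, OLt β γ → ∀ σ ∈ T γ,
    functional c (zeroJump γ) (Nat.pair (Nat.pair γ β) (Encodable.encode σ)) =
      Part.some (Encodable.encode (Γ γ β σ))
  map_expansionary : ∀ γ ∈ I, ∀ β, OLt β γ → Expansionary (T γ) (Γ γ β)
  map_mem : ∀ γ ∈ I, ∀ β, OLt β γ → ∀ σ ∈ T γ, Γ γ β σ ∈ T β
  map_self : ∀ γ ∈ I, ∀ σ ∈ T γ, Γ γ γ σ = σ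
  map_homeo : ∀ γ ∈ I, ∀ β, OLt β γ →
    ∃ h : treePaths (T γ) ≃ₜ treePaths (T β), ∀ f, SendsPath (Γ γ β) f.1 (h f).1
  map_comp : ∀ γ ∈ I, ∀ γ' β, OLt γ' γ → OLt β γ' → ∀ σ ∈ T γ,
    Γ γ β σ = Γ γ' β (Γ γ γ' σ)

namespace TreeTower

/-- `[T₀]`, the set of paths through the root of the tower. -/
def rootPaths (𝒯 : TreeTower) : Set (ℕ → ℕ) := treePaths (𝒯.T 0)

/-- `I⁻`, the set of non-maximal elements of the index path. -/
def nonMax (𝒯 : TreeTower) : Set ℕ := {β | β ∈ 𝒯.I ∧ ∃ γ ∈ 𝒯.I, OLt β γ}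

/-- `f = g^β`: the path `f` through `T β` is the one which is sent to the path `g` through the
root. -/
def IsLift (𝒯 : TreeTower) (β : ℕ) (g f : ℕ → ℕ) : Prop :=
  f ∈ treePaths (𝒯.T β) ∧ SendsPath (𝒯.Γ β 0) f g

/-- The image of `T γ` in `T β`. -/
def image (𝒯 : TreeTower) (γ β : ℕ) : Set (List ℕ) := 𝒯.Γ γ β '' 𝒯.T γ

/-- Subgeneric towers. -/
structure IsSubgeneric (𝒯 : TreeTower) : Prop where
  /-- The jump of `0^(β) ⊕ g^β` is computable from `0^(β+1) ⊕ g^(β+1)`, uniformly. -/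
  jump : ∃ c : Code, ∀ β ∈ 𝒯.nonMax, ∀ g ∈ 𝒯.rootPaths, ∀ f f',
    𝒯.IsLift β g f → 𝒯.IsLift (succNote β) g f' →
      ∀ n, functional c (join (zeroJump (succNote β)) f') (Nat.pair β n) =
        Part.some (turingJump (join (zeroJump β) f) n)
  nontrivial : ∀ β ∈ 𝒯.nonMax, ∀ f ∈ treePaths (𝒯.T β), ¬ TRed f (zeroJump β)
  incomparable : ∀ β ∈ 𝒯.nonMax, ∀ f ∈ treePaths (𝒯.T β), ∀ h ∈ treePaths (𝒯.T β),
    f ≠ h → ¬ TRed f (join (zeroJump β) h)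
  splitting : ∀ l ∈ 𝒯.nonMax, ∀ β, OLt β l → ∀ c : Code, ∀ f ∈ treePaths (𝒯.T β),
    (∀ α, OLe β α → OLt α l → SplittingOver c (zeroJump β) (𝒯.image α β) f) →
      SplittingOver c (zeroJump β) (𝒯.image l β) f
  generic : ∀ β ∈ 𝒯.nonMax, ∀ W : Set (List ℕ), REIn (zeroJump β) W →
    ∀ f ∈ treePaths (𝒯.T β), ∃ n,
      restr f n ∈ W ∨ ∀ τ, restr f n <+: τ → τ ∉ W ∩ 𝒯.T β

end TreeTower

/-!
Fix a subgeneric tower and a path `g` through its root. Everything below level `β` is computed from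
the two reals `0^(β)` and `g`.

*Computing the jumps.* The functions of a tower preserve incompatibility, so `g^β` is found from
`0^(β) ⊕ g` by a search for strings of `T β` whose images in the root are initial segments of `g`
(`TreeTower.uReal_lift`); conversely `g` is computable from `0^(β) ⊕ g^β` (`TreeTower.uReal_root`).
The real `g^(β)` consists of columns. If `g^(k)` is computable from `0^(k) ⊕ g`, hence from
`0^(k) ⊕ g^k`, then its jump is computable from the jump of the latter, and so from
`0^(k+1) ⊕ g^(k+1)` by the first property of subgeneric towers. The recursion theorem turns this
into a single functional which computes `g^(β)` from `0^(β) ⊕ g` at all levels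
(`TreeTower.IsSubgeneric.exists_functional_jumpIter`). To evaluate the column at `k + 1`, it needs
`0^(k+1)` from `0^(β)` alone; this is possible since the order of `𝒪` below a given notation is
linear and recursively enumerable, hence decidable (`UDecidable.oLe`). A similar recursion shows
that `0^(β)` is computable from `g^(β)` (`exists_functional_zeroJump`). The clauses on `g` not being
computable then follow from the corresponding properties of the lifts.

*The meet clause.* Let `X` be computable from both `g^(β')` and `0^(β)`, where `β' < β`. Then `X` is
the image of `f = g^β'` under a `0^(β')`-computable functional. If `T β'` is not splitting over `f`,
a search through `T β'` computes `X` from `0^(β')` (`TreeTower.tRed_of_not_splittingOver`).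
Otherwise splitting is inherited by the images of all higher levels, by well-founded induction, and
in particular by that of `T β`. But then the strings in `T β` whose image gives a wrong value of `X`
form a set that is r.e. in `0^(β)` and dense along `g^β`, so by genericity `g^β` itself has an
initial segment in this set, which is absurd (`TreeTower.IsSubgeneric.not_tRed_of_splittingOver`).

*Relative computability.* The uniformity claims are expressed by `UPartrec O a F`: the values `F i`
are computed from oracles `O i` and inputs `a i`, uniformly in `i`, where `i` ranges over an
arbitrary type of contexts. A context may contain non-computable data and hypotheses, such as a
path through the root or the correctness of an index below `β`. The closure properties of this
notion, the normal form (`UPartrec.exists_functional`), the s-m-n theorem (`UPartrec.smn`) and the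
recursion theorem (`UPartrec.exists_recursive`) hold for any type of contexts.
-/


/-! ### Initial segments of reals -/

@[simp] theorem length_restr (X : ℕ → ℕ) (k : ℕ) : (restr X k).length = k := by simp [restr]

theorem take_restr (X : ℕ → ℕ) (j k : ℕ) : (restr X k).take j = restr X (min j k) := by
  simp [restr, ← List.map_take]

theorem restr_prefix (X : ℕ → ℕ) {j k : ℕ} (h : j ≤ k) : restr X j <+: restr X k := by
  rw [List.prefix_iff_eq_take, length_restr, take_restr, min_eq_left h]

@[simp] theorem getElem_restr (X : ℕ → ℕ) (k j : ℕ) (h : j < (restr X k).length) :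
    (restr X k)[j] = X j := by simp [restr]

theorem getElem?_restr (X : ℕ → ℕ) (k j : ℕ) :
    (restr X k)[j]? = if j < k then some (X j) else none := by
  split_ifs with h
  · rw [List.getElem?_eq_getElem (by simpa using h), getElem_restr]
  · rw [List.getElem?_eq_none (by simpa using h)]

theorem restr_succ (X : ℕ → ℕ) (k : ℕ) : restr X (k + 1) = restr X k ++ [X k] := by
  simp [restr, List.range_succ]

/-! ### Uniform relative computability -/

/-- The partial value `F i` is computed from the oracle `O i` and the input `a i`, uniformly in the
context `i`. The context may carry hypotheses on the oracle and the input, so that nothing is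
claimed outside its range. The computation is presented by a partial recursive function `ψ` which
reads a finite part of the oracle, and whose answers persist when a longer part is read. -/
def UPartrec {ι α β : Type*} [Primcodable α] [Primcodable β] (O : ι → ℕ → ℕ) (a : ι → α)
    (F : ι → Part β) : Prop :=
  ∃ ψ : List ℕ × α →. β, Partrec ψ ∧
    (∀ σ τ x y, σ <+: τ → y ∈ ψ (σ, x) → y ∈ ψ (τ, x)) ∧
    ∀ i y, y ∈ F i ↔ ∃ k, y ∈ ψ (restr (O i) k, a i)

/-- Total values `f i` which are computed from `O i` and `a i`, uniformly in `i`. -/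
def UComputable {ι α β : Type*} [Primcodable α] [Primcodable β] (O : ι → ℕ → ℕ) (a : ι → α)
    (f : ι → β) : Prop :=
  UPartrec O a fun i => Part.some (f i)

/-- Reals `Y i` which are computed from `O i` and `a i`, uniformly in `i`. -/
def UReal {ι α : Type*} [Primcodable α] (O : ι → ℕ → ℕ) (a : ι → α) (Y : ι → ℕ → ℕ) : Prop :=
  UComputable (fun q : ι × ℕ => O q.1) (fun q => (a q.1, q.2)) fun q => Y q.1 q.2

section Calculus

variable {ι κ α β γ δ : Type*} [Primcodable α] [Primcodable β] [Primcodable γ] [Primcodable δ]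
  {O : ι → ℕ → ℕ} {a : ι → α}

theorem UPartrec.of_eq {F G : ι → Part β} (hF : UPartrec O a F) (h : ∀ i, F i = G i) :
    UPartrec O a G := (funext h : F = G) ▸ hF

theorem UComputable.of_eq {f g : ι → β} (hf : UComputable O a f) (h : ∀ i, f i = g i) :
    UComputable O a g := (funext h : f = g) ▸ hf

theorem UPartrec.reindex {F : ι → Part β} (hF : UPartrec O a F) (r : κ → ι) :
    UPartrec (fun j => O (r j)) (fun j => a (r j)) fun j => F (r j) := by
  obtain ⟨ψ, h1, h2, h3⟩ := hF
  exact ⟨ψ, h1, h2, fun j y => h3 _ y⟩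

theorem UComputable.reindex {f : ι → β} (hf : UComputable O a f) (r : κ → ι) :
    UComputable (fun j => O (r j)) (fun j => a (r j)) fun j => f (r j) :=
  UPartrec.reindex hf r

theorem UPartrec.of_partrec {h : α →. β} (hh : Partrec h) : UPartrec O a fun i => h (a i) :=
  ⟨fun z => h z.2, hh.comp Computable.snd, fun _ _ _ _ _ h => h, fun i y => by simp⟩

theorem UComputable.of_computable {h : α → β} (hh : Computable h) :
    UComputable O a fun i => h (a i) :=
  UPartrec.of_partrec (h := fun x => Part.some (h x)) hh

theorem UComputable.input : UComputable O a a := UComputable.of_computable Computable.id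

theorem UComputable.fst {b : ι → β} : UComputable O (fun i => (a i, b i)) a :=
  UComputable.of_computable (Computable.fst (α := α) (β := β))

theorem UComputable.snd {b : ι → β} : UComputable O (fun i => (a i, b i)) b :=
  UComputable.of_computable (Computable.snd (α := α) (β := β))

theorem UComputable.const (b : β) : UComputable O a fun _ => b :=
  UComputable.of_computable (Computable.const b)

theorem UPartrec.bind {F : ι → Part β} {G : ι × β → Part γ} (hF : UPartrec O a F)
    (hG : UPartrec (fun q : ι × β => O q.1) (fun q => (a q.1, q.2)) G) :
    UPartrec O a fun i => (F i).bind fun b => G (i, b) := by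
  obtain ⟨ψ, h1, h2, h3⟩ := hF
  obtain ⟨φ, k1, k2, k3⟩ := hG
  refine ⟨fun z => (ψ z).bind fun b => φ (z.1, (z.2, b)), ?_, ?_, ?_⟩
  · exact h1.bind (k1.comp (Computable.pair (Computable.fst.comp Computable.fst)
      (Computable.pair (Computable.snd.comp Computable.fst) Computable.snd)))
  · intro σ τ x y hστ h
    rw [Part.mem_bind_iff] at h ⊢
    obtain ⟨b, hb, hy⟩ := h
    exact ⟨b, h2 _ _ _ _ hστ hb, k2 _ _ _ _ hστ hy⟩
  · intro i y
    simp only [Part.mem_bind_iff]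
    constructor
    · rintro ⟨b, hb, hy⟩
      obtain ⟨m, hm⟩ := (h3 _ _).1 hb
      obtain ⟨n, hn⟩ := (k3 _ _).1 hy
      exact ⟨max m n, b, h2 _ _ _ _ (restr_prefix _ (le_max_left _ _)) hm,
        k2 _ _ _ _ (restr_prefix _ (le_max_right _ _)) hn⟩
    · rintro ⟨k, b, hb, hy⟩
      exact ⟨b, (h3 _ _).2 ⟨k, hb⟩, (k3 (i, b) _).2 ⟨k, hy⟩⟩

/-- Whatever is computed from the oracle and computable values `f i` is computed from the oracle and
the original input. Contexts are the same throughout, so that facts about them remain available. -/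
theorem UPartrec.cut {f : ι → β} {F : ι → Part γ} (hf : UComputable O a f)
    (hF : UPartrec O f F) : UPartrec O a F := by
  obtain ⟨ψ, h1, h2, h3⟩ := hf
  obtain ⟨φ, k1, k2, k3⟩ := hF
  refine ⟨fun z => (ψ z).bind fun b => φ (z.1, b), ?_, ?_, ?_⟩
  · exact h1.bind (k1.comp (Computable.pair (Computable.fst.comp Computable.fst) Computable.snd))
  · intro σ τ x y hστ h
    rw [Part.mem_bind_iff] at h ⊢
    obtain ⟨b, hb, hy⟩ := h
    exact ⟨b, h2 _ _ _ _ hστ hb, k2 _ _ _ _ hστ hy⟩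
  · intro i y
    simp only [Part.mem_bind_iff]
    constructor
    · intro hy
      obtain ⟨m, hm⟩ := (h3 i (f i)).1 (Part.mem_some _)
      obtain ⟨n, hn⟩ := (k3 _ _).1 hy
      exact ⟨max m n, f i, h2 _ _ _ _ (restr_prefix _ (le_max_left _ _)) hm,
        k2 _ _ _ _ (restr_prefix _ (le_max_right _ _)) hn⟩
    · rintro ⟨k, b, hb, hy⟩
      have : b = f i := Part.mem_some_iff.1 ((h3 _ _).2 ⟨k, hb⟩)
      exact (k3 i _).2 ⟨k, this ▸ hy⟩

theorem UComputable.cut {f : ι → β} {g : ι → γ} (hf : UComputable O a f)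
    (hg : UComputable O f g) : UComputable O a g := UPartrec.cut hf hg

theorem UComputable.comp {h : β → γ} (hh : Computable h) {f : ι → β} (hf : UComputable O a f) :
    UComputable O a fun i => h (f i) := hf.cut (.of_computable hh)

theorem UComputable.pair {f : ι → β} {g : ι → γ} (hf : UComputable O a f)
    (hg : UComputable O a g) : UComputable O a fun i => (f i, g i) := by
  have h1 : UPartrec (fun q : ι × β => O q.1) (fun q => (a q.1, q.2))
      fun q => Part.some (q.2, g q.1) := by
    have h2 : UComputable (fun q : ι × β => O q.1) (fun q => (a q.1, q.2)) fun q => g q.1 :=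
      (UComputable.fst).cut (hg.reindex Prod.fst)
    refine (UPartrec.bind h2 (G := fun q => Part.some (q.1.2, q.2)) ?_).of_eq fun i => ?_
    · exact UComputable.of_computable (h := fun z : (α × β) × γ => (z.1.2, z.2))
        (Computable.pair (Computable.snd.comp Computable.fst) Computable.snd)
    · simp
  exact (UPartrec.bind hf h1).of_eq fun i => by simp

theorem UComputable.comp₂ {h : β → γ → δ} (hh : Computable₂ h) {f : ι → β} {g : ι → γ}
    (hf : UComputable O a f) (hg : UComputable O a g) : UComputable O a fun i => h (f i) (g i) :=
  UComputable.comp (h := fun p : β × γ => h p.1 p.2) hh (hf.pair hg)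

/-- Values that can be computed in the context `i` can also be computed in the extended context
`(i, b)`. -/
theorem UPartrec.weaken {F : ι → Part β} (hF : UPartrec O a F) :
    UPartrec (fun q : ι × γ => O q.1) (fun q => (a q.1, q.2)) fun q => F q.1 :=
  UPartrec.cut (UComputable.fst)
    (hF.reindex Prod.fst)

theorem UComputable.weaken {f : ι → β} (hf : UComputable O a f) :
    UComputable (fun q : ι × γ => O q.1) (fun q => (a q.1, q.2)) fun q => f q.1 :=
  UPartrec.weaken hf


/-- Definition by cases: each case has to be computed only in the contexts in which it applies. -/
theorem UPartrec.cond {c : ι → Bool} {F : ι → Part β} (hc : UComputable O a c)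
    (hF : UPartrec (fun i : {i // c i = true} => O i) (fun i => a i) fun i => F i)
    (hG : UPartrec (fun i : {i // c i = false} => O i) (fun i => a i) fun i => F i) :
    UPartrec O a F := by
  obtain ⟨ψ, h1, h2, h3⟩ := hF
  obtain ⟨φ, k1, k2, k3⟩ := hG
  obtain ⟨χ, l1, l2, l3⟩ := hc
  refine ⟨fun z => (χ z).bind fun b => bif b then ψ z else φ z, ?_, ?_, ?_⟩
  · exact l1.bind (Partrec.cond Computable.snd (h1.comp Computable.fst) (k1.comp Computable.fst))
  · intro σ τ x y hστ h
    rw [Part.mem_bind_iff] at h ⊢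
    obtain ⟨b, hb, hy⟩ := h
    refine ⟨b, l2 _ _ _ _ hστ hb, ?_⟩
    cases b
    · exact k2 _ _ _ _ hστ hy
    · exact h2 _ _ _ _ hστ hy
  · intro i y
    simp only [Part.mem_bind_iff]
    constructor
    · intro hy
      obtain ⟨m, hm⟩ := (l3 i (c i)).1 (Part.mem_some _)
      cases hci : c i
      · obtain ⟨n, hn⟩ := (k3 ⟨i, hci⟩ _).1 hy
        exact ⟨max m n, c i, l2 _ _ _ _ (restr_prefix _ (le_max_left _ _)) hm,
          by rw [hci]; exact k2 _ _ _ _ (restr_prefix _ (le_max_right _ _)) hn⟩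
      · obtain ⟨n, hn⟩ := (h3 ⟨i, hci⟩ _).1 hy
        exact ⟨max m n, c i, l2 _ _ _ _ (restr_prefix _ (le_max_left _ _)) hm,
          by rw [hci]; exact h2 _ _ _ _ (restr_prefix _ (le_max_right _ _)) hn⟩
    · rintro ⟨k, b, hb, hy⟩
      have : b = c i := Part.mem_some_iff.1 ((l3 _ _).2 ⟨k, hb⟩)
      subst this
      cases hci : c i
      · exact (k3 ⟨i, hci⟩ _).2 ⟨k, by simpa [hci] using hy⟩
      · exact (h3 ⟨i, hci⟩ _).2 ⟨k, by simpa [hci] using hy⟩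

theorem UComputable.cond {c : ι → Bool} {f : ι → β} (hc : UComputable O a c)
    (hf : UComputable (fun i : {i // c i = true} => O i) (fun i => a i) fun i => f i)
    (hg : UComputable (fun i : {i // c i = false} => O i) (fun i => a i) fun i => f i) :
    UComputable O a f := UPartrec.cond hc hf hg

theorem mem_natRfind {p : ℕ → Part Bool} {n : ℕ} :
    n ∈ Nat.rfind p ↔ true ∈ p n ∧ ∀ m < n, false ∈ p m :=
  Nat.mem_rfind

theorem UPartrec.rfind {p : ι × ℕ → Part Bool}
    (hp : UPartrec (fun q : ι × ℕ => O q.1) (fun q => (a q.1, q.2)) p) :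
    UPartrec O a fun i => Nat.rfind fun n => p (i, n) := by
  obtain ⟨ψ, h1, h2, h3⟩ := hp
  refine ⟨fun z => Nat.rfind fun n => ψ (z.1, (z.2, n)), ?_, ?_, ?_⟩
  · exact Partrec.rfind (h1.comp (Computable.pair (Computable.fst.comp Computable.fst)
      (Computable.pair (Computable.snd.comp Computable.fst) Computable.snd)))
  · intro σ τ x y hστ h
    have h := mem_natRfind.1 h
    exact mem_natRfind.2 ⟨h2 _ _ _ _ hστ h.1, fun m hm => h2 _ _ _ _ hστ (h.2 m hm)⟩
  · intro i y
    refine mem_natRfind.trans (Iff.trans ?_ (exists_congr fun k => mem_natRfind).symm)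
    constructor
    · rintro ⟨ht, hf⟩
      obtain ⟨m, hm⟩ := (h3 _ _).1 ht
      have : ∀ n ≤ y, ∃ k, ∀ j < n, false ∈ ψ (restr (O i) k, (a i, j)) := by
        intro n
        induction n with
        | zero => exact fun _ => ⟨0, by simp⟩
        | succ n ih =>
          intro hn
          obtain ⟨k, hk⟩ := ih (by omega)
          obtain ⟨l, hl⟩ := (h3 _ _).1 (hf n (by omega))
          refine ⟨max k l, fun j hj => ?_⟩
          rcases Nat.lt_succ_iff_lt_or_eq.1 hj with hj | rfl
          · exact h2 _ _ _ _ (restr_prefix _ (le_max_left _ _)) (hk j hj)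
          · exact h2 _ _ _ _ (restr_prefix _ (le_max_right _ _)) hl
      obtain ⟨k, hk⟩ := this y le_rfl
      exact ⟨max m k, h2 _ _ _ _ (restr_prefix _ (le_max_left _ _)) hm,
        fun j hj => h2 _ _ _ _ (restr_prefix _ (le_max_right _ _)) (hk _ hj)⟩
    · rintro ⟨k, ht, hf⟩
      exact ⟨(h3 (i, y) _).2 ⟨k, ht⟩, fun j hj => (h3 (i, j) _).2 ⟨k, hf j hj⟩⟩

theorem UPartrec.natRec {n : ι → ℕ} {F : ι → Part β} {H : ι × (ℕ × β) → Part β}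
    (hn : UComputable O a n) (hF : UPartrec O a F)
    (hH : UPartrec (fun q : ι × (ℕ × β) => O q.1) (fun q => (a q.1, q.2)) H) :
    UPartrec O a fun i =>
      Nat.rec (F i) (fun k r => r.bind fun b => H (i, (k, b))) (n i) := by
  refine UPartrec.cut (UComputable.input.pair hn) ?_
  obtain ⟨ψ, h1, h2, h3⟩ := hF
  obtain ⟨φ, k1, k2, k3⟩ := hH
  refine ⟨fun z => Nat.rec (ψ (z.1, z.2.1))
      (fun k r => r.bind fun b => φ (z.1, (z.2.1, (k, b)))) z.2.2, ?_, ?_, ?_⟩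
  · refine Partrec.nat_rec (f := fun z : List ℕ × (α × ℕ) => z.2.2)
      (g := fun z => ψ (z.1, z.2.1)) (h := fun z q => φ (z.1, (z.2.1, q)))
      (Computable.snd.comp Computable.snd)
      (h1.comp (Computable.pair Computable.fst (Computable.fst.comp Computable.snd))) ?_
    exact k1.comp (Computable.pair (Computable.fst.comp Computable.fst)
      (Computable.pair (Computable.fst.comp (Computable.snd.comp Computable.fst))
        Computable.snd))
  · rintro σ τ ⟨x, m⟩ y hστ h
    dsimp only at h ⊢
    induction m generalizing y with
    | zero => exact h2 _ _ _ _ hστ h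
    | succ m ih =>
      obtain ⟨b, hb, hy⟩ := Part.mem_bind_iff.1 h
      exact Part.mem_bind_iff.2 ⟨b, ih _ hb, k2 _ _ _ _ hστ hy⟩
  · intro i y
    dsimp only
    generalize n i = m
    induction m generalizing y with
    | zero => exact h3 _ _
    | succ m ih =>
      have mono : ∀ m σ τ x y, σ <+: τ →
          y ∈ (Nat.rec (ψ (σ, x)) (fun k r => r.bind fun b => φ (σ, (x, (k, b)))) m : Part β) →
          y ∈ (Nat.rec (ψ (τ, x)) (fun k r => r.bind fun b => φ (τ, (x, (k, b)))) m :
            Part β) := by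
        intro m σ τ x y hστ h
        induction m generalizing y with
        | zero => exact h2 _ _ _ _ hστ h
        | succ m ih =>
          obtain ⟨b, hb, hy⟩ := Part.mem_bind_iff.1 h
          exact Part.mem_bind_iff.2 ⟨b, ih _ hb, k2 _ _ _ _ hστ hy⟩
      simp only [Part.mem_bind_iff]
      constructor
      · rintro ⟨b, hb, hy⟩
        obtain ⟨k, hk⟩ := (ih _).1 hb
        obtain ⟨l, hl⟩ := (k3 _ _).1 hy
        exact ⟨max k l, b, mono _ _ _ _ _ (restr_prefix _ (le_max_left _ _)) hk,
          k2 _ _ _ _ (restr_prefix _ (le_max_right _ _)) hl⟩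
      · rintro ⟨k, b, hb, hy⟩
        exact ⟨b, (ih _).2 ⟨k, hb⟩, (k3 (i, (m, b)) _).2 ⟨k, hy⟩⟩

theorem UComputable.oracle {f : ι → ℕ} (hf : UComputable O a f) :
    UComputable O a fun i => O i (f i) := by
  refine hf.cut ⟨fun z => (z.1[z.2]? : Option ℕ), ?_, ?_, ?_⟩
  · exact (Computable.list_getElem?.comp Computable.fst Computable.snd).ofOption
  · rintro σ τ x y ⟨ρ, rfl⟩ h
    simp only [Part.mem_ofOption, Option.mem_def] at h ⊢
    exact (List.getElem?_append_left (List.getElem?_eq_some_iff.1 h).1).trans h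
  · intro i y
    simp only [Part.mem_ofOption, Option.mem_def, getElem?_restr, Part.mem_some_iff]
    constructor
    · rintro rfl
      exact ⟨f i + 1, by simp⟩
    · rintro ⟨k, hk⟩
      split_ifs at hk
      simpa using hk.symm

theorem UReal.oracle : UReal O a O :=
  UComputable.oracle (O := fun q : ι × ℕ => O q.1) UComputable.snd

theorem UReal.app {Y : ι → ℕ → ℕ} (hY : UReal O a Y) {n : ι → ℕ} (hn : UComputable O a n) :
    UComputable O a fun i => Y i (n i) :=
  (UComputable.input.pair hn).cut (UComputable.reindex hY fun i => (i, n i))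

theorem UReal.restr {Y : ι → ℕ → ℕ} (hY : UReal O a Y) {n : ι → ℕ} (hn : UComputable O a n) :
    UComputable O a fun i => restr (Y i) (n i) := by
  have h1 : UPartrec (fun q : ι × (ℕ × List ℕ) => O q.1) (fun q => (a q.1, q.2))
      fun q => Part.some (q.2.2 ++ [Y q.1 q.2.1]) := by
    have h2 : UComputable (fun q : ι × (ℕ × List ℕ) => O q.1) (fun q => (a q.1, q.2))
        fun q => Y q.1 q.2.1 :=
      (UComputable.of_computable (h := fun z : α × (ℕ × List ℕ) => (z.1, z.2.1))
        (Computable.pair Computable.fst (Computable.fst.comp Computable.snd))).cut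
        (UComputable.reindex hY fun q : ι × (ℕ × List ℕ) => (q.1, q.2.1))
    exact UComputable.comp₂ (Computable.list_concat (α := ℕ)) (UComputable.of_computable
      (h := fun z : α × (ℕ × List ℕ) => z.2.2) (Computable.snd.comp Computable.snd)) h2
  refine (UPartrec.natRec hn (UComputable.const []) h1).of_eq fun i => ?_
  dsimp only
  generalize n i = m
  induction m with
  | zero => rfl
  | succ m ih => simp [ih, restr_succ]

theorem UPartrec.rfindOpt {f : ι × ℕ → Option β}
    (hf : UComputable (fun q : ι × ℕ => O q.1) (fun q => (a q.1, q.2)) f) :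
    UPartrec O a fun i => Nat.rfindOpt fun n => f (i, n) := by
  have h1 : UPartrec O a fun i => Nat.rfind fun n => Part.some (f (i, n)).isSome :=
    UPartrec.rfind (p := fun q => Part.some (f q).isSome)
      (UComputable.comp Primrec.option_isSome.to_comp hf)
  refine UPartrec.bind (G := fun q : ι × ℕ => (f q : Part β)) h1 ?_
  exact UPartrec.cut hf (UPartrec.of_partrec Computable.id.ofOption)

/-- A partial recursive function is the union of its computable approximations by stages. -/
theorem Partrec.exists_stage {ψ : α →. β} (hψ : Partrec ψ) :
    ∃ θ : α → ℕ → Option β, Computable₂ θ ∧ ∀ x y, y ∈ ψ x ↔ ∃ s, θ x s = some y := by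
  obtain ⟨c, hc⟩ := Code.exists_code.1 hψ
  refine ⟨fun x s => (Code.evaln s c (Encodable.encode x)).bind Encodable.decode, ?_, ?_⟩
  · refine Computable.option_bind ?_ (Computable.decode.comp Computable.snd)
    exact Code.primrec_evaln.to_comp.comp (Computable.pair
      (Computable.pair Computable.snd (Computable.const c)) (Computable.encode.comp Computable.fst))
  · intro x y
    have h1 : ∀ v, v ∈ c.eval (Encodable.encode x) ↔ ∃ y ∈ ψ x, Encodable.encode y = v := by
      intro v; simp [hc]
    simp only [Option.bind_eq_some_iff]
    constructor
    · intro hy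
      obtain ⟨s, hs⟩ := Code.evaln_complete.1 ((h1 _).2 ⟨y, hy, rfl⟩)
      exact ⟨s, _, hs, Encodable.encodek y⟩
    · rintro ⟨s, v, hs, hv⟩
      obtain ⟨y', hy', rfl⟩ := (h1 _).1 (Code.evaln_sound hs)
      rw [Encodable.encodek] at hv
      exact Option.some_injective _ hv ▸ hy'

/-- A uniformly partial recursive value is found by a search for the first stage at which a total
computable test on the initial segments of the oracle has an answer. -/
theorem UPartrec.exists_search {F : ι → Part β} (hF : UPartrec O a F) :
    ∃ θ : List ℕ → α → Option β, Computable₂ θ ∧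
      ∀ i, F i = Nat.rfindOpt fun k => θ (restr (O i) k) (a i) := by
  obtain ⟨ψ, h1, h2, h3⟩ := hF
  obtain ⟨θ, hθ, hθ'⟩ := h1.exists_stage
  -- the length of the string codes both the part of the oracle to be read and the stage
  refine ⟨fun σ x => θ (σ.take σ.length.unpair.1, x) σ.length.unpair.2, ?_, fun i => ?_⟩
  · have hu : Computable fun z : List ℕ × α => z.1.length.unpair :=
      Computable.unpair.comp (Computable.list_length.comp Computable.fst)
    exact hθ.comp (Computable.pair (Primrec.list_take.to_comp.comp
      (Computable.fst.comp hu) Computable.fst) Computable.snd) (Computable.snd.comp hu)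
  · have key : ∀ y, y ∈ F i ↔ ∃ k, θ ((restr (O i) k).take (restr (O i) k).length.unpair.1, a i)
        (restr (O i) k).length.unpair.2 = some y := by
      intro y
      simp only [length_restr, take_restr, min_eq_left (Nat.unpair_left_le _)]
      rw [h3]
      simp only [hθ']
      constructor
      · rintro ⟨k, s, h⟩
        exact ⟨Nat.pair k s, by simpa using h⟩
      · rintro ⟨k, h⟩
        exact ⟨_, _, h⟩
    refine Part.ext fun y => ⟨fun hy => ?_, fun hy => ?_⟩
    · obtain ⟨k, hk⟩ := (key y).1 hy
      obtain ⟨y', hy'⟩ := Part.dom_iff_mem.1 ((Nat.rfindOpt_dom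
        (f := fun k => θ ((restr (O i) k).take (restr (O i) k).length.unpair.1, a i)
          (restr (O i) k).length.unpair.2)).2 ⟨k, y, Option.mem_def.2 hk⟩)
      obtain ⟨m, hm⟩ := Nat.rfindOpt_spec hy'
      exact Part.mem_unique ((key y').2 ⟨m, hm⟩) hy ▸ hy'
    · obtain ⟨m, hm⟩ := Nat.rfindOpt_spec hy
      exact (key y).2 ⟨m, hm⟩

/-- Transitivity: an oracle that is computed from another oracle can be replaced by it. -/
theorem UPartrec.changeOracle {Y : ι → ℕ → ℕ} {F : ι → Part β} (hY : UReal O a Y)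
    (hF : UPartrec Y a F) : UPartrec O a F := by
  obtain ⟨θ, hθ, h⟩ := hF.exists_search
  refine (UPartrec.rfindOpt (f := fun q : ι × ℕ => θ (_root_.restr (Y q.1) q.2) (a q.1)) ?_).of_eq
    fun i => (h i).symm
  have h1 : UReal (fun q : ι × ℕ => O q.1) (fun q => (a q.1, q.2)) fun q => Y q.1 :=
    (UComputable.of_computable (h := fun z : (α × ℕ) × ℕ => (z.1.1, z.2))
      (Computable.pair (Computable.fst.comp Computable.fst) Computable.snd)).cut
      (UComputable.reindex hY fun q : (ι × ℕ) × ℕ => (q.1.1, q.2))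
  exact UComputable.comp₂ hθ (h1.restr UComputable.snd)
    UComputable.fst

end Calculus

/-! ### Reals computed from oracles -/

section Reals

variable {ι κ α β γ δ : Type*} [Primcodable α] [Primcodable β] [Primcodable γ] [Primcodable δ]
  {O : ι → ℕ → ℕ} {a : ι → α}

theorem UReal.reindex {Y : ι → ℕ → ℕ} (hY : UReal O a Y) (r : κ → ι) :
    UReal (fun j => O (r j)) (fun j => a (r j)) fun j => Y (r j) :=
  UComputable.reindex hY fun q : κ × ℕ => (r q.1, q.2)

theorem UReal.cut {f : ι → β} {Y : ι → ℕ → ℕ} (hf : UComputable O a f) (hY : UReal O f Y) :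
    UReal O a Y :=
  (hf.weaken.pair UComputable.snd).cut hY

theorem UReal.weaken {Y : ι → ℕ → ℕ} (hY : UReal O a Y) :
    UReal (fun q : ι × γ => O q.1) (fun q => (a q.1, q.2)) fun q => Y q.1 :=
  UReal.cut UComputable.fst (hY.reindex Prod.fst)

theorem UComputable.changeOracle {Y : ι → ℕ → ℕ} {f : ι → β} (hY : UReal O a Y)
    (hf : UComputable Y a f) : UComputable O a f := UPartrec.changeOracle hY hf

theorem UReal.trans {Y Z : ι → ℕ → ℕ} (hY : UReal O a Y) (hZ : UReal Y a Z) : UReal O a Z :=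
  UComputable.changeOracle hY.weaken hZ

theorem UReal.join {Y Z : ι → ℕ → ℕ} (hY : UReal O a Y) (hZ : UReal O a Z) :
    UReal O a fun i => join (Y i) (Z i) := by
  have hn : UComputable (fun q : ι × ℕ => O q.1) (fun q => (a q.1, q.2)) fun q => q.2 / 2 :=
    UComputable.comp (Primrec.nat_div.comp Primrec.id (Primrec.const 2)).to_comp UComputable.snd
  have h : Computable fun p : ℕ × (ℕ × ℕ) => if p.1 % 2 = 0 then p.2.1 else p.2.2 :=
    (Primrec.ite (Primrec.eq.comp (Primrec.nat_mod.comp Primrec.fst (Primrec.const 2))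
      (Primrec.const 0)) (Primrec.fst.comp Primrec.snd) (Primrec.snd.comp Primrec.snd)).to_comp
  exact UComputable.comp h (UComputable.snd.pair ((hY.weaken.app hn).pair (hZ.weaken.app hn)))

theorem UReal.join_left {A B : ι → ℕ → ℕ} : UReal (fun i => _root_.join (A i) (B i)) a A := by
  have hn : UComputable (fun q : ι × ℕ => _root_.join (A q.1) (B q.1)) (fun q => (a q.1, q.2))
      fun q => 2 * q.2 :=
    UComputable.comp (Primrec.nat_mul.comp (Primrec.const 2) Primrec.id).to_comp UComputable.snd
  exact (UComputable.oracle hn).of_eq fun q => by simp [_root_.join]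

theorem UReal.join_right {A B : ι → ℕ → ℕ} : UReal (fun i => _root_.join (A i) (B i)) a B := by
  have hn : UComputable (fun q : ι × ℕ => _root_.join (A q.1) (B q.1)) (fun q => (a q.1, q.2))
      fun q => 2 * q.2 + 1 :=
    UComputable.comp (Primrec.succ.comp
      (Primrec.nat_mul.comp (Primrec.const 2) Primrec.id)).to_comp UComputable.snd
  refine (UComputable.oracle hn).of_eq fun q => ?_
  have h1 : (2 * q.2 + 1) % 2 = 1 := by omega
  have h2 : (2 * q.2 + 1) / 2 = q.2 := by omega
  simp [_root_.join, h1, h2]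

/-! ### Decidable predicates and search -/

open Classical in
/-- The predicate `P i` is decided from `O i` and `a i`, uniformly in `i`. -/
def UDecidable (O : ι → ℕ → ℕ) (a : ι → α) (P : ι → Prop) : Prop :=
  UComputable O a fun i => decide (P i)

theorem UDecidable.of_bool {P : ι → Prop} {f : ι → Bool} (hf : UComputable O a f)
    (h : ∀ i, f i = true ↔ P i) : UDecidable O a P := by
  classical
  exact hf.of_eq fun i => by rw [Bool.eq_iff_iff, h, decide_eq_true_iff]

theorem UDecidable.bool {P : ι → Prop} (hP : UDecidable O a P) :
    ∃ f : ι → Bool, UComputable O a f ∧ ∀ i, f i = true ↔ P i := by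
  classical
  exact ⟨_, hP, fun i => decide_eq_true_iff⟩

theorem UDecidable.of_iff {P Q : ι → Prop} (hP : UDecidable O a P) (h : ∀ i, P i ↔ Q i) :
    UDecidable O a Q := by
  obtain ⟨f, hf, hf'⟩ := hP.bool
  exact .of_bool hf fun i => (hf' i).trans (h i)

theorem UDecidable.of_primrec {p : β → Prop} (hp : PrimrecPred p) {f : ι → β}
    (hf : UComputable O a f) : UDecidable O a fun i => p (f i) := by
  obtain ⟨_, hp⟩ := hp
  exact .of_bool (UComputable.comp hp.to_comp hf) fun i => decide_eq_true_iff

theorem UDecidable.eq {f g : ι → β} [DecidableEq β] (hf : UComputable O a f)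
    (hg : UComputable O a g) : UDecidable O a fun i => f i = g i :=
  UDecidable.of_primrec (p := fun p : β × β => p.1 = p.2) Primrec.eq (hf.pair hg)

theorem UDecidable.not {P : ι → Prop} (hP : UDecidable O a P) : UDecidable O a fun i => ¬ P i := by
  obtain ⟨f, hf, hf'⟩ := hP.bool
  exact .of_bool (UComputable.comp Primrec.not.to_comp hf) fun i => by simp [← hf' i]

theorem UDecidable.and {P Q : ι → Prop} (hP : UDecidable O a P) (hQ : UDecidable O a Q) :
    UDecidable O a fun i => P i ∧ Q i := by
  obtain ⟨f, hf, hf'⟩ := hP.bool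
  obtain ⟨g, hg, hg'⟩ := hQ.bool
  exact .of_bool (UComputable.comp₂ Primrec.and.to_comp hf hg) fun i => by simp [← hf', ← hg']

theorem UDecidable.or {P Q : ι → Prop} (hP : UDecidable O a P) (hQ : UDecidable O a Q) :
    UDecidable O a fun i => P i ∨ Q i :=
  (hP.not.and hQ.not).not.of_iff fun i => by tauto

/-- A conjunction whose second part is decided only where the first part holds. -/
theorem UDecidable.and_of {P Q : ι → Prop} (hP : UDecidable O a P)
    (hQ : UDecidable (fun i : {i // P i} => O i) (fun i => a i) fun i => Q i) :
    UDecidable O a fun i => P i ∧ Q i := by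
  classical
  refine UComputable.cond hP ?_ ?_
  · refine (UComputable.reindex hQ fun i : {i // decide (P i) = true} =>
      ⟨i.1, of_decide_eq_true i.2⟩).of_eq fun i => ?_
    simp [of_decide_eq_true i.2]
  · exact (UComputable.const false).of_eq fun i => by simp [of_decide_eq_false i.2]

/-- The least witness of a decidable property of numbers. -/
theorem UDecidable.find {P : ι × ℕ → Prop}
    (hP : UDecidable (fun q : ι × ℕ => O q.1) (fun q => (a q.1, q.2)) P)
    (h : ∀ i, ∃ n, P (i, n)) :
    ∃ f : ι → ℕ, UComputable O a f ∧ ∀ i, P (i, f i) ∧ ∀ m < f i, ¬ P (i, m) := by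
  classical
  refine ⟨fun i => Nat.find (h i), ?_, fun i => ⟨Nat.find_spec (h i), fun m => Nat.find_min _⟩⟩
  refine (UPartrec.rfind hP).of_eq fun i => Part.eq_some_iff.2 (mem_natRfind.2 ⟨?_, ?_⟩)
  · simpa using Nat.find_spec (h i)
  · intro m hm
    simpa using Nat.find_min (h i) hm

/-- Some witness of a decidable property is found by a search. -/
theorem UDecidable.search [Inhabited γ] {P : ι × γ → Prop}
    (hP : UDecidable (fun q : ι × γ => O q.1) (fun q => (a q.1, q.2)) P)
    (h : ∀ i, ∃ c, P (i, c)) : ∃ f : ι → γ, UComputable O a f ∧ ∀ i, P (i, f i) := by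
  have he : Computable fun n => (Encodable.decode (α := γ) n).getD default :=
    Computable.option_getD Computable.decode (Computable.const default)
  have h1 : UDecidable (fun q : ι × ℕ => O q.1) (fun q => (a q.1, q.2))
      fun q => P (q.1, (Encodable.decode (α := γ) q.2).getD default) :=
    (UComputable.of_computable (h := fun z : α × ℕ =>
      (z.1, (Encodable.decode (α := γ) z.2).getD default))
      (Computable.pair Computable.fst (he.comp Computable.snd))).cut
      (UComputable.reindex hP fun q : ι × ℕ => (q.1, (Encodable.decode (α := γ) q.2).getD default))
  obtain ⟨f, hf, hf'⟩ := h1.find fun i => by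
    obtain ⟨c, hc⟩ := h i
    exact ⟨Encodable.encode c, by simpa using hc⟩
  exact ⟨_, UComputable.comp he hf, fun i => (hf' i).1⟩

theorem UDecidable.semidecide [Inhabited γ] {P : ι × γ → Prop}
    (hP : UDecidable (fun q : ι × γ => O q.1) (fun q => (a q.1, q.2)) P) :
    ∃ F : ι → Part ℕ, UPartrec O a F ∧ ∀ i, (F i).Dom ↔ ∃ c, P (i, c) := by
  classical
  have he : Computable fun n => (Encodable.decode (α := γ) n).getD default :=
    Computable.option_getD Computable.decode (Computable.const default)
  have h1 : UDecidable (fun q : ι × ℕ => O q.1) (fun q => (a q.1, q.2))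
      fun q => P (q.1, (Encodable.decode (α := γ) q.2).getD default) :=
    (UComputable.of_computable (h := fun z : α × ℕ =>
      (z.1, (Encodable.decode (α := γ) z.2).getD default))
      (Computable.pair Computable.fst (he.comp Computable.snd))).cut
      (UComputable.reindex hP fun q : ι × ℕ => (q.1, (Encodable.decode (α := γ) q.2).getD default))
  refine ⟨_, UPartrec.rfind h1, fun i => ⟨fun hd => ?_, ?_⟩⟩
  · have h2 := (mem_natRfind.1 (Part.get_mem hd)).1
    exact ⟨_, of_decide_eq_true (Part.mem_some_iff.1 h2).symm⟩
  · rintro ⟨c, hc⟩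
    refine Nat.rfind_dom.2 ⟨Encodable.encode c, ?_, fun _ => trivial⟩
    simpa using hc

theorem UDecidable.forall_lt {P : ι × ℕ → Prop} {n : ι → ℕ}
    (hP : UDecidable (fun q : ι × ℕ => O q.1) (fun q => (a q.1, q.2)) P)
    (hn : UComputable O a n) : UDecidable O a fun i => ∀ j < n i, P (i, j) := by
  have hle : PrimrecPred fun p : ℕ × ℕ => p.1 ≤ p.2 := Primrec.nat_le
  obtain ⟨f, hf, hf'⟩ := UDecidable.find (P := fun q => n q.1 ≤ q.2 ∨ ¬ P q)
    ((UDecidable.of_primrec hle (hn.weaken.pair UComputable.snd)).or hP.not)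
    fun i => ⟨n i, Or.inl le_rfl⟩
  refine (UDecidable.of_primrec hle (hn.pair hf)).of_iff fun i => ⟨fun h j hj => ?_, fun h => ?_⟩
  · have := (hf' i).2 j (lt_of_lt_of_le hj h)
    tauto
  · by_contra hlt
    rcases (hf' i).1 with h1 | h1
    · exact hlt h1
    · exact h1 (h _ (not_le.1 hlt))

theorem UDecidable.exists_lt {P : ι × ℕ → Prop} {n : ι → ℕ}
    (hP : UDecidable (fun q : ι × ℕ => O q.1) (fun q => (a q.1, q.2)) P)
    (hn : UComputable O a n) : UDecidable O a fun i => ∃ j < n i, P (i, j) :=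
  (UDecidable.forall_lt hP.not hn).not.of_iff fun i => by push Not; rfl

theorem UComputable.ite {P : ι → Prop} [DecidablePred P] {f g : ι → β} (hP : UDecidable O a P)
    (hf : UComputable (fun i : {i // P i} => O i) (fun i => a i) fun i => f i)
    (hg : UComputable (fun i : {i // ¬ P i} => O i) (fun i => a i) fun i => g i) :
    UComputable O a fun i => if P i then f i else g i := by
  have hP' : UComputable O a fun i => decide (P i) :=
    UComputable.of_eq hP fun i => by congr
  refine UComputable.cond hP' ?_ ?_
  · refine (UComputable.reindex hf fun i : {i // decide (P i) = true} =>
      ⟨i.1, of_decide_eq_true i.2⟩).of_eq fun i => ?_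
    simp [of_decide_eq_true i.2]
  · refine (UComputable.reindex hg fun i : {i // decide (P i) = false} =>
      ⟨i.1, of_decide_eq_false i.2⟩).of_eq fun i => ?_
    simp [of_decide_eq_false i.2]

/-! ### Kleene's normal form, the s-m-n theorem and the recursion theorem -/

theorem UPartrec.functional {c : ι → Code} {n : ι → ℕ} (hc : UComputable O a c)
    (hn : UComputable O a n) : UPartrec O a fun i => functional (c i) (O i) (n i) := by
  have h1 : UPartrec (fun q : ι × ℕ => O q.1) (fun q => (a q.1, q.2)) fun q =>
      (c q.1).eval (Nat.pair (Encodable.encode (restr (O q.1) q.2)) (n q.1)) := by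
    have h2 : UComputable (fun q : ι × ℕ => O q.1) (fun q => (a q.1, q.2)) fun q =>
        (c q.1, Nat.pair (Encodable.encode (restr (O q.1) q.2)) (n q.1)) :=
      hc.weaken.pair (UComputable.comp₂ Primrec₂.natPair.to_comp (UComputable.comp
        Computable.encode (UReal.oracle.restr UComputable.snd)) hn.weaken)
    exact UPartrec.cut h2 (UPartrec.of_partrec (h := fun z : Code × ℕ => z.1.eval z.2) Code.eval_part)
  have h3 {δ : Type} [Primcodable δ] {h : ℕ → δ} (hh : Computable h) :
      UPartrec (fun q : ι × ℕ => O q.1) (fun q => (a q.1, q.2)) fun q =>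
        ((c q.1).eval (Nat.pair (Encodable.encode (restr (O q.1) q.2)) (n q.1))).map h :=
    (UPartrec.bind h1 (G := fun z => Part.some (h z.2))
      (UComputable.comp hh UComputable.snd)).of_eq fun q => by simp [Part.bind_some_eq_map]
  have h4 : Computable fun v : ℕ => decide (v ≠ 0) :=
    Primrec.not.to_comp.comp (Primrec.eq.decide.comp Primrec.id (Primrec.const 0)).to_comp
      |>.of_eq fun v => by simp
  exact UPartrec.bind (UPartrec.rfind (h3 h4)) (h3 Computable.pred)

theorem UPartrec.functional_real {c : ι → Code} {n : ι → ℕ} {Y : ι → ℕ → ℕ}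
    (hY : UReal O a Y) (hc : UComputable O a c) (hn : UComputable O a n) :
    UPartrec O a fun i => _root_.functional (c i) (Y i) (n i) := by
  refine UPartrec.cut (UComputable.input.pair (hc.pair hn)) (UPartrec.changeOracle
    (UReal.cut UComputable.fst hY)
    (UPartrec.functional ?_ ?_))
  · exact UComputable.of_computable (h := fun z : α × Code × ℕ => z.2.1)
      (Computable.fst.comp Computable.snd)
  · exact UComputable.of_computable (h := fun z : α × Code × ℕ => z.2.2)
      (Computable.snd.comp Computable.snd)

/-- A machine that answers with the code of `θ k` on the initial segment of length `k` computes
the first value of `θ`. -/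
theorem functional_eq_rfindOpt {c : Code} {X : ℕ → ℕ} {n : ℕ} {θ : ℕ → Option ℕ}
    (h : ∀ k, c.eval (Nat.pair (Encodable.encode (restr X k)) n) =
      Part.some (Encodable.encode (θ k))) :
    functional c X n = Nat.rfindOpt θ := by
  simp only [functional, h, Part.map_some, Nat.rfindOpt]
  have h1 : ∀ k, decide (Encodable.encode (θ k) ≠ 0) = (θ k).isSome := fun k => by
    cases θ k <;> simp
  simp only [h1]
  refine Part.ext fun y => ?_
  simp only [Part.mem_bind_iff]
  refine exists_congr fun k => and_congr_right fun hk => ?_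
  have h2 : true = (θ k).isSome := Part.mem_some_iff.1 (mem_natRfind.1 hk).1
  obtain ⟨v, hv⟩ := Option.isSome_iff_exists.1 h2.symm
  simp [hv]

/-- The s-m-n theorem: the parameter `x i` is moved from the input to the index. -/
theorem UPartrec.smn {x : ι → α} {n : ι → ℕ} {F : ι → Part ℕ}
    (hF : UPartrec O (fun i => (x i, n i)) F) :
    ∃ s : α → Code, Computable s ∧ ∀ i, _root_.functional (s (x i)) (O i) (n i) = F i := by
  obtain ⟨θ, hθ, h⟩ := hF.exists_search
  have h1 : Computable fun m : ℕ => Encodable.encode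
      ((Encodable.decode (α := α) m.unpair.1).bind fun x =>
        (Encodable.decode (α := List ℕ) m.unpair.2.unpair.1).bind fun σ =>
          θ σ (x, m.unpair.2.unpair.2)) := by
    refine Computable.encode.comp (Computable.option_bind
      (Computable.decode.comp (Computable.fst.comp Computable.unpair)) ?_)
    have hu : Computable fun q : ℕ × α => q.1.unpair.2.unpair :=
      Computable.unpair.comp (Computable.snd.comp (Computable.unpair.comp Computable.fst))
    refine Computable.option_bind (Computable.decode.comp (Computable.fst.comp hu)) ?_
    exact hθ.comp Computable.snd (Computable.pair (Computable.snd.comp Computable.fst)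
      (Computable.snd.comp (hu.comp Computable.fst)))
  obtain ⟨c, hc⟩ := Code.exists_code.1 (Partrec.nat_iff.1 h1.partrec)
  refine ⟨fun x => c.curry (Encodable.encode x), Code.primrec₂_curry.to_comp.comp
    (Computable.const c) Computable.encode, fun i => ?_⟩
  rw [h]
  refine functional_eq_rfindOpt fun k => ?_
  rw [Code.eval_curry, hc]
  simp

/-- The normal form: a uniformly partial recursive value is given by a single index. -/
theorem UPartrec.exists_functional {n : ι → ℕ} {F : ι → Part ℕ} (hF : UPartrec O n F) :
    ∃ c, ∀ i, _root_.functional c (O i) (n i) = F i := by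
  obtain ⟨s, -, hs⟩ := UPartrec.smn (x := fun _ : ι => ()) (n := n) (F := F)
    (UPartrec.cut UComputable.snd hF)
  exact ⟨s (), hs⟩

/-- The recursion theorem: a functional may make use of its own index `c`. In the contexts where
the parameter `e i` is this index, it takes the value `F i`. -/
theorem UPartrec.exists_recursive {e : ι → Code} {n : ι → ℕ} {F : ι → Part ℕ}
    (hF : UPartrec O (fun i => (e i, n i)) F) :
    ∃ c, ∀ i, e i = c → _root_.functional c (O i) (n i) = F i := by
  obtain ⟨θ, hθ, h⟩ := hF.exists_search
  have h1 : Computable₂ fun (c : Code) (m : ℕ) => Encodable.encode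
      ((Encodable.decode (α := List ℕ) m.unpair.1).bind fun σ => θ σ (c, m.unpair.2)) := by
    have hu : Computable fun q : Code × ℕ => q.2.unpair := Computable.unpair.comp Computable.snd
    refine Computable.encode.comp (Computable.option_bind
      (Computable.decode.comp (Computable.fst.comp hu)) ?_)
    exact hθ.comp Computable.snd (Computable.pair (Computable.fst.comp Computable.fst)
      (Computable.snd.comp (hu.comp Computable.fst)))
  obtain ⟨c, hc⟩ := Code.fixed_point₂ h1.partrec₂
  refine ⟨c, fun i hi => ?_⟩
  rw [h]
  refine functional_eq_rfindOpt fun k => ?_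
  rw [hc, hi]
  simp

end Reals

/-! ### Turing reducibility -/

theorem functional_recursiveIn (c : Code) (X : ℕ → ℕ) :
    Nat.RecursiveIn {(X : ℕ →. ℕ)} (functional c X) := by
  have hX : Nat.RecursiveIn {(X : ℕ →. ℕ)} (X : ℕ →. ℕ) := .oracle _ rfl
  have prim {f : ℕ → ℕ} (hf : Primrec f) : Nat.RecursiveIn {(X : ℕ →. ℕ)} (f : ℕ →. ℕ) :=
    (Primrec.nat_iff.1 hf).recursiveIn
  -- the code of the initial segment of length `k`, as a function of a pair `(_, k)`
  have hR : Nat.RecursiveIn {(X : ℕ →. ℕ)}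
      fun p => Part.some (Encodable.encode (restr X p.unpair.2)) := by
    have hg : Primrec fun m : ℕ => Encodable.encode
        ((Denumerable.ofNat (List ℕ) m.unpair.1) ++ [m.unpair.2]) := by
      have := Primrec.unpair
      exact Primrec.encode.comp (Primrec.list_concat.comp
        ((Primrec.ofNat (List ℕ)).comp (Primrec.fst.comp this)) (Primrec.snd.comp this))
    have hX' : Nat.RecursiveIn {(X : ℕ →. ℕ)} fun q => Part.some (X q.unpair.2.unpair.1) := by
      refine (Nat.RecursiveIn.comp hX (prim (f := fun q => q.unpair.2.unpair.1)
        (Primrec.fst.comp (Primrec.unpair.comp (Primrec.snd.comp Primrec.unpair))))).of_eq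
        fun q => ?_
      exact Part.bind_some _ _
    have hs := Nat.RecursiveIn.comp (prim hg) (Nat.RecursiveIn.pair
      (prim (f := fun q => q.unpair.2.unpair.2)
        (Primrec.snd.comp (Primrec.unpair.comp (Primrec.snd.comp Primrec.unpair)))) hX')
    refine (Nat.RecursiveIn.prec (prim (Primrec.const (Encodable.encode ([] : List ℕ)))) hs).of_eq
      fun p => ?_
    simp only
    generalize p.unpair.2 = k
    induction k with
    | zero => rfl
    | succ k ih =>
      simp only [ih]
      refine (Part.bind_some _ _).trans ?_
      simp only [Seq.seq, Nat.unpair_pair, PFun.coe_val, Part.map_eq_map, Part.map_some,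
        Part.bind_some, restr_succ]
      refine (Part.bind_some _ _).trans ?_
      simp
  have hv : Nat.RecursiveIn {(X : ℕ →. ℕ)} fun p =>
      c.eval (Nat.pair (Encodable.encode (restr X p.unpair.2)) p.unpair.1) := by
    refine (Nat.RecursiveIn.comp (Nat.Partrec.recursiveIn (Code.exists_code.2 ⟨c, rfl⟩))
      (Nat.RecursiveIn.pair hR (prim (Primrec.fst.comp Primrec.unpair)))).of_eq fun p => ?_
    simp only [Seq.seq, PFun.coe_val, Part.map_eq_map, Part.map_some, Part.bind_some]
    exact Part.bind_some _ _
  have hr := Nat.RecursiveIn.rfind (Nat.RecursiveIn.comp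
    (prim (f := fun v => if v = 0 then 1 else 0) (Primrec.ite (Primrec.eq.comp Primrec.id
      (Primrec.const 0)) (Primrec.const 1) (Primrec.const 0))) hv)
  refine (Nat.RecursiveIn.comp (Nat.RecursiveIn.comp (prim Primrec.pred) hv)
    (Nat.RecursiveIn.pair (prim Primrec.id) hr)).of_eq fun n => ?_
  have h1 : (fun k => (fun m => decide (m = 0)) <$>
      (c.eval (Nat.pair (Encodable.encode (restr X (Nat.pair n k).unpair.2))
        (Nat.pair n k).unpair.1) >>= fun v => Part.some (if v = 0 then 1 else 0))) =
      fun k => (c.eval (Nat.pair (Encodable.encode (restr X k)) n)).map fun v =>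
        decide (v ≠ 0) := by
    funext k
    simp only [Nat.unpair_pair, Part.bind_eq_bind, Part.bind_some_eq_map, Part.map_eq_map,
      Part.map_map]
    congr 1
    funext v
    by_cases hv : v = 0 <;> simp [hv]
  simp only [functional]
  erw [h1]
  simp only [Seq.seq, PFun.coe_val, Part.map_eq_map, Part.map_some, Part.bind_some]
  refine (Part.bind_map _ _ _).trans ?_
  congr 1
  funext k
  simp only [id, Nat.unpair_pair]
  exact Part.bind_some_eq_map _ _

theorem UPartrec.of_recursiveIn {g : ℕ → ℕ} {f : ℕ →. ℕ}
    (hf : Nat.RecursiveIn {(g : ℕ →. ℕ)} f) :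
    UPartrec (fun _ : ℕ => g) (id : ℕ → ℕ) f := by
  induction hf with
  | zero => exact UComputable.const 0
  | succ => exact UComputable.of_computable Computable.succ
  | left => exact UComputable.of_computable (Computable.fst.comp Computable.unpair)
  | right => exact UComputable.of_computable (Computable.snd.comp Computable.unpair)
  | oracle h hh =>
    obtain rfl : h = _ := hh
    exact UComputable.oracle UComputable.input
  | @pair f h _ _ ihf ihh =>
    refine (UPartrec.bind ihf (G := fun q => (h q.1).map fun v => Nat.pair q.2 v) ?_).of_eq
      fun n => ?_
    · refine (UPartrec.bind ihh.weaken (G := fun q => Part.some (Nat.pair q.1.2 q.2)) ?_).of_eq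
        fun q => ?_
      · exact UComputable.of_computable (h := fun z : (ℕ × ℕ) × ℕ => Nat.pair z.1.2 z.2)
          (Primrec₂.natPair.comp (Primrec.snd.comp Primrec.fst) Primrec.snd).to_comp
      · simp [Part.bind_some_eq_map]
    · simp [Seq.seq, Part.bind_map]
  | @comp f h _ _ ihf ihh =>
    exact UPartrec.bind ihh (G := fun q : ℕ × ℕ => f q.2)
      (UPartrec.cut UComputable.snd (ihf.reindex fun q : ℕ × ℕ => q.2))
  | @prec f h _ _ ihf ihh =>
    have h1 : Computable fun q : ℕ × (ℕ × ℕ) => Nat.pair q.1.unpair.1 (Nat.pair q.2.1 q.2.2) :=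
      (Primrec₂.natPair.comp (Primrec.fst.comp (Primrec.unpair.comp Primrec.fst))
        (Primrec₂.natPair.comp (Primrec.fst.comp Primrec.snd)
          (Primrec.snd.comp Primrec.snd))).to_comp
    have h2 : Computable fun q : ℕ => q.unpair.1 := Computable.fst.comp Computable.unpair
    exact UPartrec.natRec (n := fun p : ℕ => p.unpair.2) (F := fun p => f p.unpair.1)
      (H := fun q : ℕ × (ℕ × ℕ) => h (Nat.pair q.1.unpair.1 (Nat.pair q.2.1 q.2.2)))
      (UComputable.of_computable (Computable.snd.comp Computable.unpair))
      (UPartrec.cut (UComputable.of_computable h2) (ihf.reindex fun p : ℕ => p.unpair.1))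
      (UPartrec.cut (UComputable.of_computable h1) (ihh.reindex
        fun q : ℕ × (ℕ × ℕ) => Nat.pair q.1.unpair.1 (Nat.pair q.2.1 q.2.2)))
  | @rfind f _ ihf =>
    refine UPartrec.rfind (p := fun q : ℕ × ℕ => (f (Nat.pair q.1 q.2)).map fun m =>
      decide (m = 0)) ?_
    have h1 : UPartrec (fun _ : ℕ × ℕ => g) (fun q : ℕ × ℕ => (id q.1, q.2))
        fun q => f (Nat.pair q.1 q.2) :=
      UPartrec.cut (UComputable.of_computable (h := fun z : ℕ × ℕ => Nat.pair z.1 z.2)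
        Primrec₂.natPair.to_comp) (ihf.reindex fun q : ℕ × ℕ => Nat.pair q.1 q.2)
    have h2 : Computable fun m : ℕ => decide (m = 0) :=
      (Primrec.eq.decide.comp Primrec.id (Primrec.const 0)).to_comp
    exact (UPartrec.bind h1 (G := fun z => Part.some (decide (z.2 = 0)))
      (UComputable.comp h2 UComputable.snd)).of_eq fun q => by simp [Part.bind_some_eq_map]

section TuringReducibility

variable {ι α : Type*} [Primcodable α] {O : ι → ℕ → ℕ} {a : ι → α}

theorem TRed.uReal {f g : ℕ → ℕ} (h : TRed f g) : UReal (fun _ : ι => g) a fun _ => f :=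
  UComputable.snd.cut
    ((UPartrec.of_recursiveIn (RecursiveIn.iff_nat.1 h)).reindex fun q : ι × ℕ => q.2)

theorem UReal.tRed {Y : ι → ℕ → ℕ} (hY : UReal O a Y) (i : ι) : TRed (Y i) (O i) := by
  have h1 : UComputable (fun _ : ℕ => O i) id (Y i) :=
    (UComputable.of_computable (h := fun n : ℕ => (a i, n))
      (Computable.pair (Computable.const _) Computable.id)).cut
      (UComputable.reindex hY fun n : ℕ => (i, n))
  obtain ⟨c, hc⟩ := UPartrec.exists_functional h1
  refine RecursiveIn.iff_nat.2 ((functional_recursiveIn c (O i)).of_eq fun n => ?_)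
  exact hc n

theorem TRed.exists_functional {f g : ℕ → ℕ} (h : TRed f g) :
    ∃ c, ∀ n, functional c g n = Part.some (f n) :=
  UPartrec.exists_functional (UPartrec.of_recursiveIn (RecursiveIn.iff_nat.1 h))

theorem TRed.trans {f g h : ℕ → ℕ} (h1 : TRed f g) (h2 : TRed g h) : TRed f h :=
  TuringReducible.trans h1 h2

theorem tRed_join_left (f g : ℕ → ℕ) : TRed f (join f g) :=
  (UReal.join_left (a := fun _ : Unit => ()) (A := fun _ => f) (B := fun _ => g)).tRed ()

theorem TRed.join {f g h : ℕ → ℕ} (h1 : TRed f h) (h2 : TRed g h) : TRed (join f g) h :=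
  UReal.tRed (a := fun _ : Unit => ()) (UReal.join h1.uReal h2.uReal) ()

theorem REIn.of_uPartrec {A : ℕ → ℕ} {W : Set (List ℕ)} {F : List ℕ → Part ℕ}
    (hF : UPartrec (fun _ : List ℕ => A) id F) (hW : ∀ σ, σ ∈ W ↔ (F σ).Dom) : REIn A W := by
  have h1 : UPartrec (fun _ : ℕ => A) id fun n => F (Denumerable.ofNat (List ℕ) n) :=
    UPartrec.cut (UComputable.of_computable (Computable.ofNat (List ℕ)))
      (hF.reindex fun n => Denumerable.ofNat (List ℕ) n)
  obtain ⟨c, hc⟩ := h1.exists_functional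
  refine ⟨F, (functional_recursiveIn c A).of_eq fun n => ?_, hW⟩
  rw [show functional c A n = _ from hc n]
  simp [Part.map_id']

end TuringReducibility

/-! ### The order of Kleene's `𝒪` -/

theorem KleeneO.of_noteStep {a b : ℕ} (hb : KleeneO b) (h : NoteStep a b) : KleeneO a := by
  rcases noteStep_cases h with rfl | ⟨e, n, rfl, ha⟩
  · generalize hc : succNote a = c at hb
    cases hb with
    | zero => simp [succNote] at hc
    | succ b hb => exact (show b = a by simp only [succNote] at hc; omega) ▸ hb
    | lim e s => simp only [succNote, limNote] at hc; omega
  · generalize hc : limNote e = c at hb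
    cases hb with
    | zero => simp [limNote] at hc
    | succ b hb => simp only [succNote, limNote] at hc; omega
    | lim e' s hs hO =>
      obtain rfl : e = e' := by simp only [limNote] at hc; omega
      exact Part.mem_unique (hs n) ha ▸ hO n

theorem KleeneO.of_reflTransGen {a b : ℕ} (hb : KleeneO b)
    (h : Relation.ReflTransGen NoteStep a b) : KleeneO a := by
  induction h with
  | refl => exact hb
  | tail _ h ih => exact ih (hb.of_noteStep h)

theorem oLe_iff {a b : ℕ} : OLe a b ↔ KleeneO b ∧ Relation.ReflTransGen NoteStep a b := by
  rw [OLe, Relation.reflTransGen_iff_eq_or_transGen, eq_comm]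

theorem OLe.kleeneO_left {a b : ℕ} (h : OLe a b) : KleeneO a :=
  h.1.of_reflTransGen (oLe_iff.1 h).2

theorem OLt.oLe {a b : ℕ} (h : OLt a b) : OLe a b := ⟨h.1, Or.inr h.2⟩

theorem OLe.trans {a b c : ℕ} (h1 : OLe a b) (h2 : OLe b c) : OLe a c :=
  oLe_iff.2 ⟨h2.1, (oLe_iff.1 h1).2.trans (oLe_iff.1 h2).2⟩

theorem OLt.trans_oLe {a b c : ℕ} (h1 : OLt a b) (h2 : OLe b c) : OLt a c := by
  rcases h2 with ⟨hc, rfl | h⟩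
  · exact h1
  · exact ⟨hc, h1.2.trans h⟩

theorem OLe.trans_oLt {a b c : ℕ} (h1 : OLe a b) (h2 : OLt b c) : OLt a c := by
  rcases h1 with ⟨hb, rfl | h⟩
  · exact h2
  · exact ⟨h2.1, h.trans h2.2⟩

theorem OLt.irrefl (a : ℕ) : ¬ OLt a a := fun h => OLt.wellFounded.irrefl.irrefl a h

theorem OLe.eq_or_oLt {a b : ℕ} (h : OLe a b) : a = b ∨ OLt a b :=
  h.2.imp id fun h' => ⟨h.1, h'⟩

theorem oLt_succNote {a : ℕ} (h : KleeneO (succNote a)) : OLt a (succNote a) :=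
  ⟨h, Relation.TransGen.single (NoteStep.succ a)⟩

theorem reflTransGen_noteStep_cases {a b : ℕ} (h : Relation.ReflTransGen NoteStep a b) :
    a = b ∨ ∃ c, Relation.ReflTransGen NoteStep a c ∧ NoteStep c b := by
  cases h with
  | refl => exact Or.inl rfl
  | tail h1 h2 => exact Or.inr ⟨_, h1, h2⟩

/-- The notations below a given one are linearly ordered. -/
theorem KleeneO.comparable {b : ℕ} (hb : KleeneO b) : ∀ {a c : ℕ},
    Relation.ReflTransGen NoteStep a b → Relation.ReflTransGen NoteStep c b →
      Relation.ReflTransGen NoteStep a c ∨ Relation.ReflTransGen NoteStep c a := by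
  induction hb with
  | zero =>
    have h0 : ∀ a, Relation.ReflTransGen NoteStep a 0 → a = 0 := fun a h => by
      rcases reflTransGen_noteStep_cases h with h | ⟨d, -, h⟩
      · exact h
      · rcases noteStep_cases h with h | ⟨e, n, h, -⟩ <;> simp [succNote, limNote] at h
    intro a c ha hc
    rw [h0 a ha, h0 c hc]
    exact Or.inl .refl
  | succ d _ ih =>
    have h0 : ∀ a, Relation.ReflTransGen NoteStep a (succNote d) →
        a = succNote d ∨ Relation.ReflTransGen NoteStep a d := fun a h => by
      rcases reflTransGen_noteStep_cases h with h | ⟨d', h', h⟩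
      · exact Or.inl h
      · rcases noteStep_cases h with h | ⟨e, n, h, -⟩
        · exact Or.inr ((show d' = d by simp only [succNote] at h; omega) ▸ h')
        · simp only [succNote, limNote] at h; omega
    intro a c ha hc
    rcases h0 a ha with rfl | ha'
    · exact Or.inr hc
    · rcases h0 c hc with rfl | hc'
      · exact Or.inl ha
      · exact ih ha' hc'
  | lim e s hs _ hlt ih =>
    have h0 : ∀ a, Relation.ReflTransGen NoteStep a (limNote e) →
        a = limNote e ∨ ∃ n, Relation.ReflTransGen NoteStep a (s n) := fun a h => by
      rcases reflTransGen_noteStep_cases h with h | ⟨d', h', h⟩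
      · exact Or.inl h
      · rcases noteStep_cases h with h | ⟨e', n, h, hn⟩
        · simp only [succNote, limNote] at h; omega
        · obtain rfl : e = e' := by simp only [limNote] at h; omega
          exact Or.inr ⟨n, Part.mem_unique hn (hs n) ▸ h'⟩
    have hmono : ∀ m n, m ≤ n → Relation.ReflTransGen NoteStep (s m) (s n) := fun m n hmn => by
      induction hmn with
      | refl => exact .refl
      | step _ ih => exact ih.trans (hlt _).to_reflTransGen
    intro a c ha hc
    rcases h0 a ha with rfl | ⟨m, ha'⟩
    · exact Or.inr hc
    · rcases h0 c hc with rfl | ⟨n, hc'⟩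
      · exact Or.inl ha
      · exact ih (max m n) (ha'.trans (hmono _ _ (le_max_left _ _)))
          (hc'.trans (hmono _ _ (le_max_right _ _)))

theorem zero_oLe {b : ℕ} (hb : KleeneO b) : OLe 0 b := by
  refine oLe_iff.2 ⟨hb, ?_⟩
  induction hb with
  | zero => exact .refl
  | succ a _ ih => exact ih.tail (.succ a)
  | lim e s hs _ _ ih => exact (ih 0).tail (.lim e 0 _ (hs 0))

/-! ### Deciding the order below a notation -/

/-- One step down from the notation `b`: to the predecessor of a successor, and to the member with
index `w.1` of the sequence with limit `b`, if it is found within `w.2` steps. -/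
def stepDown (b : ℕ) (w : ℕ × ℕ) : Option ℕ :=
  if b = 0 then none
  else if b % 2 = 1 then some (b / 2)
  else Code.evaln w.2 (Denumerable.ofNat Code (b / 2 - 1)) w.1

theorem noteStep_iff_stepDown {a b : ℕ} : NoteStep a b ↔ ∃ w, stepDown b w = some a := by
  constructor
  · intro h
    rcases noteStep_cases h with rfl | ⟨e, n, rfl, ha⟩
    · refine ⟨(0, 0), ?_⟩
      have h1 : (2 * a + 1) % 2 = 1 := by omega
      have h2 : (2 * a + 1) / 2 = a := by omega
      simp [stepDown, succNote, h1, h2]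
    · obtain ⟨t, ht⟩ := Code.evaln_complete.1 ha
      refine ⟨(n, t), ?_⟩
      have h1 : (2 * e + 2) % 2 ≠ 1 := by omega
      have h2 : (2 * e + 2) / 2 - 1 = e := by omega
      simpa [stepDown, limNote, h1, h2] using ht
  · rintro ⟨⟨n, t⟩, h⟩
    rw [stepDown] at h
    split_ifs at h with h0 h1
    · obtain rfl := Option.some_injective _ h
      have : b = succNote (b / 2) := by simp only [succNote]; omega
      have h2 := NoteStep.succ (b / 2)
      rwa [← this] at h2
    · have : b = limNote (b / 2 - 1) := by simp only [limNote]; omega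
      have h2 := NoteStep.lim _ n a (Code.evaln_sound h)
      rwa [← this] at h2

/-- The notation that is reached from `b` by a list of steps down. -/
def descend (b : ℕ) (l : List (ℕ × ℕ)) : Option ℕ :=
  l.foldl (fun o w => o.bind fun c => stepDown c w) (some b)

theorem reflTransGen_iff_descend {a b : ℕ} :
    Relation.ReflTransGen NoteStep a b ↔ ∃ l, descend b l = some a := by
  constructor
  · intro h
    induction h using Relation.ReflTransGen.head_induction_on with
    | refl => exact ⟨[], rfl⟩
    | head h _ ih =>
      obtain ⟨l, hl⟩ := ih
      obtain ⟨w, hw⟩ := noteStep_iff_stepDown.1 h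
      refine ⟨l ++ [w], ?_⟩
      rw [descend, List.foldl_append, ← descend, hl]
      exact hw
  · rintro ⟨l, hl⟩
    induction l using List.reverseRecOn generalizing a with
    | nil => exact Option.some_injective _ hl ▸ .refl
    | append_singleton l w ih =>
      rw [descend, List.foldl_append, ← descend] at hl
      obtain ⟨c, hc, hw⟩ := Option.bind_eq_some_iff.1 hl
      exact (ih hc).head (noteStep_iff_stepDown.2 ⟨w, hw⟩)

theorem primrec₂_stepDown : Primrec₂ stepDown := by
  have hb : Primrec fun z : ℕ × (ℕ × ℕ) => z.1 := Primrec.fst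
  have hhalf : Primrec fun z : ℕ × (ℕ × ℕ) => z.1 / 2 :=
    Primrec.nat_div.comp hb (Primrec.const 2)
  refine Primrec.ite (Primrec.eq.comp hb (Primrec.const 0)) (Primrec.const none)
    (Primrec.ite (Primrec.eq.comp (Primrec.nat_mod.comp hb (Primrec.const 2)) (Primrec.const 1))
      (Primrec.option_some.comp hhalf) ?_)
  exact Code.primrec_evaln.comp (Primrec.pair (Primrec.pair (Primrec.snd.comp Primrec.snd)
    ((Primrec.ofNat Code).comp (Primrec.nat_sub.comp hhalf (Primrec.const 1))))
    (Primrec.fst.comp Primrec.snd))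

theorem primrec₂_descend : Primrec₂ descend := by
  refine Primrec.list_foldl (f := fun z : ℕ × List (ℕ × ℕ) => z.2) (g := fun z => some z.1)
    (h := fun _ q => q.1.bind fun c => stepDown c q.2) Primrec.snd
    (Primrec.option_some.comp Primrec.fst) ?_
  refine Primrec.option_bind (Primrec.fst.comp Primrec.snd) ?_
  exact primrec₂_stepDown.comp Primrec.snd (Primrec.snd.comp (Primrec.snd.comp Primrec.fst))

section

variable {ι α β : Type*} [Primcodable α] {O : ι → ℕ → ℕ} {a : ι → α}

/-- Below a common bound, the order of `𝒪` is decidable: by linearity, a search for a descent from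
one notation to the other is bound to succeed. -/
theorem UDecidable.oLe {b c d : ι → ℕ} (hc : UComputable O a c) (hd : UComputable O a d)
    (hcb : ∀ i, OLe (c i) (b i)) (hdb : ∀ i, OLe (d i) (b i)) :
    UDecidable O a fun i => OLe (c i) (d i) := by
  have h1 {u v : ι → ℕ} (hu : UComputable O a u) (hv : UComputable O a v) :
      UDecidable (fun q : ι × List (ℕ × ℕ) => O q.1) (fun q => (a q.1, q.2))
        fun q => descend (u q.1) q.2 = some (v q.1) :=
    UDecidable.eq (UComputable.comp₂ primrec₂_descend.to_comp hu.weaken UComputable.snd)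
      (UComputable.comp Computable.option_some hv.weaken)
  obtain ⟨l, hl, hl'⟩ := UDecidable.search
    (P := fun q => descend (d q.1) q.2 = some (c q.1) ∨
      (descend (c q.1) q.2 = some (d q.1) ∧ c q.1 ≠ d q.1))
    ((h1 hd hc).or ((h1 hc hd).and (UDecidable.eq hc hd).not.weaken)) fun i => by
      by_cases hcd : c i = d i
      · exact ⟨[], Or.inl (by simp [descend, hcd])⟩
      · rcases (hcb i).1.comparable (oLe_iff.1 (hcb i)).2 (oLe_iff.1 (hdb i)).2 with h | h
        · obtain ⟨l, hl⟩ := reflTransGen_iff_descend.1 h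
          exact ⟨l, Or.inl hl⟩
        · obtain ⟨l, hl⟩ := reflTransGen_iff_descend.1 h
          exact ⟨l, Or.inr ⟨hl, hcd⟩⟩
  refine (UDecidable.eq (UComputable.comp₂ primrec₂_descend.to_comp hd hl)
    (UComputable.comp Computable.option_some hc)).of_iff fun i => ⟨fun h => ?_, fun h => ?_⟩
  · exact oLe_iff.2 ⟨(hdb i).kleeneO_left, reflTransGen_iff_descend.2 ⟨_, h⟩⟩
  · rcases hl' i with h' | ⟨h', hne⟩
    · exact h'
    · have h2 : OLe (d i) (c i) :=
        oLe_iff.2 ⟨(hcb i).kleeneO_left, reflTransGen_iff_descend.2 ⟨_, h'⟩⟩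
      rcases h.eq_or_oLt with h3 | h3
      · exact absurd h3 hne
      · exact absurd (h3.trans_oLe h2) (OLt.irrefl _)

end

/-! ### Transfinite jumps -/

theorem jumpIter_of_oLe {X : ℕ → ℕ} {β p : ℕ} (h : OLe p.unpair.1 β) :
    jumpIter X β p = jumpColumn X p.unpair.1 p.unpair.2 + 1 := if_pos h

theorem jumpIter_ne_zero {X : ℕ → ℕ} {β p : ℕ} : jumpIter X β p ≠ 0 ↔ OLe p.unpair.1 β := by
  rw [jumpIter]
  split_ifs with h <;> simp [h]

/-- The value of `X^(β)` at an entry of the column `γ`, by cases on `γ`: only the columns at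
successors, which have odd numbers, carry a jump. -/
theorem jumpIter_cases (X : ℕ → ℕ) {β p : ℕ} (h : OLe p.unpair.1 β) :
    (p.unpair.1 = 0 ∧ jumpIter X β p = X p.unpair.2 + 1) ∨
    (∃ k, p.unpair.1 = succNote k ∧ jumpIter X β p = turingJump (jumpIter X k) p.unpair.2 + 1) ∨
    (p.unpair.1 ≠ 0 ∧ p.unpair.1 % 2 = 0 ∧ jumpIter X β p = 1) := by
  rw [jumpIter_of_oLe h]
  generalize p.unpair.1 = γ at h
  rcases h.kleeneO_left with _ | ⟨k, _⟩ | ⟨e, _⟩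
  · exact Or.inl ⟨rfl, by rw [jumpColumn_zero]⟩
  · exact Or.inr (Or.inl ⟨k, rfl, by rw [jumpColumn_succNote]⟩)
  · refine Or.inr (Or.inr ⟨by simp [limNote], by simp only [limNote]; omega, ?_⟩)
    rw [jumpColumn_limNote]

/-- For `k ≤ β`, the jump `X^(k)` is computable from `X^(β)` and `k`. -/
theorem UReal.jumpIter_of_oLe {ι : Type*} {X : ι → ℕ → ℕ} {k β : ι → ℕ}
    (h : ∀ i, OLe (k i) (β i)) :
    UReal (fun i => jumpIter (X i) (β i)) k fun i => jumpIter (X i) (k i) := by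
  classical
  have hv : UComputable (fun q : ι × ℕ => jumpIter (X q.1) (β q.1)) (fun q => (k q.1, q.2))
      fun q => jumpIter (X q.1) (β q.1) q.2 := UComputable.oracle UComputable.snd
  have h1 : UDecidable (fun q : ι × ℕ => jumpIter (X q.1) (β q.1)) (fun q => (k q.1, q.2))
      fun q => jumpIter (X q.1) (β q.1) q.2 ≠ 0 ∧ OLe q.2.unpair.1 (k q.1) := by
    refine UDecidable.and_of (UDecidable.eq hv (UComputable.const 0)).not ?_
    exact UDecidable.oLe (b := fun q => β q.1.1)
      (UComputable.comp (Computable.fst.comp Computable.unpair) UComputable.snd) UComputable.fst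
      (fun q => jumpIter_ne_zero.1 q.2) fun q => h _
  refine (UComputable.ite (f := fun q => jumpIter (X q.1) (β q.1) q.2) (g := fun _ => 0) h1
    (hv.reindex Subtype.val) (UComputable.const 0)).of_eq fun q => ?_
  simp only [jumpIter_ne_zero]
  by_cases hq : OLe q.2.unpair.1 (k q.1)
  · rw [if_pos ⟨hq.trans (h q.1), hq⟩, _root_.jumpIter_of_oLe hq,
      _root_.jumpIter_of_oLe (hq.trans (h q.1))]
  · rw [if_neg fun h' => hq h'.2, jumpIter, if_neg hq]

/-- The jump respects Turing reducibility, uniformly in the index of the reduction. -/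
theorem exists_turingJump_reduction : ∃ h : Code × ℕ → ℕ, Computable h ∧
    ∀ e (X Y : ℕ → ℕ), (∀ n, functional e X n = Part.some (Y n)) →
      ∀ x, turingJump Y x = turingJump X (h (e, x)) := by
  let ι := {z : (Code × (ℕ → ℕ) × (ℕ → ℕ)) × ℕ × ℕ //
    ∀ n, functional z.1.1 z.1.2.1 n = Part.some (z.1.2.2 n)}
  have h1 : UReal (fun z : ι => z.1.1.2.1) (fun z => ((z.1.1.1, z.1.2.1), z.1.2.2))
      fun z => z.1.1.2.2 := by
    refine (UPartrec.functional (c := fun q : ι × ℕ => q.1.1.1.1) (n := fun q => q.2)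
      ?_ UComputable.snd).of_eq fun q => q.1.2 q.2
    exact UComputable.of_computable (h := fun z : ((Code × ℕ) × ℕ) × ℕ => z.1.1.1)
      (Computable.fst.comp (Computable.fst.comp Computable.fst))
  have h2 : UPartrec (fun z : ι => z.1.1.2.1) (fun z => ((z.1.1.1, z.1.2.1), z.1.2.2))
      fun z => functional (Denumerable.ofNat Code z.1.2.1) z.1.1.2.2 z.1.2.1 := by
    have hx : UComputable (fun z : ι => z.1.1.2.1) (fun z => ((z.1.1.1, z.1.2.1), z.1.2.2))
        fun z => z.1.2.1 := UComputable.comp Computable.snd UComputable.fst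
    exact UPartrec.functional_real h1 (UComputable.comp (Computable.ofNat Code) hx) hx
  obtain ⟨s, hs, h3⟩ := h2.smn
  refine ⟨fun z => Encodable.encode (s z), Computable.encode.comp hs, fun e X Y hXY x => ?_⟩
  have h4 := h3 ⟨((e, X, Y), x, Encodable.encode (s (e, x))), hXY⟩
  simp only at h4
  rw [turingJump, turingJump, Denumerable.ofNat_encode, h4]

/-- The real `0^(β)` is computable from `X^(β)`, uniformly in `β` and `X`. -/
theorem exists_functional_zeroJump : ∃ c : Code, ∀ (X : ℕ → ℕ) (β : ℕ), KleeneO β →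
    ∀ n, functional c (jumpIter X β) n = Part.some (zeroJump β n) := by
  obtain ⟨h, hh, hred⟩ := exists_turingJump_reduction
  -- contexts: an index `e` which is correct below `β`, and an argument
  let ι := {z : (Code × (ℕ → ℕ) × ℕ) × ℕ // ∀ k, OLt k z.1.2.2 → ∀ n,
    functional z.1.1 (jumpIter z.1.2.1 k) n = Part.some (zeroJump k n)}
  have h1 : UComputable (fun z : ι => jumpIter z.1.1.2.1 z.1.1.2.2) (fun z => (z.1.1.1, z.1.2))
      fun z => zeroJump z.1.1.2.2 z.1.2 := by
    have hw : Computable fun z : Code × ℕ =>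
        Nat.pair z.2.unpair.1 (h (z.1, z.2.unpair.2)) := by
      have hu : Computable fun z : Code × ℕ => z.2.unpair :=
        Computable.unpair.comp Computable.snd
      exact Primrec₂.natPair.to_comp.comp (Computable.fst.comp hu)
        (hh.comp (Computable.pair Computable.fst (Computable.snd.comp hu)))
    have hf : Computable fun z : ℕ × ℕ × ℕ =>
        if z.2.1 = 0 then 0 else if z.1.unpair.1 % 2 = 1 then z.2.2 else 1 :=
      (Primrec.ite (Primrec.eq.comp (Primrec.fst.comp Primrec.snd) (Primrec.const 0))
        (Primrec.const 0) (Primrec.ite (Primrec.eq.comp (Primrec.nat_mod.comp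
          (Primrec.fst.comp (Primrec.unpair.comp Primrec.fst)) (Primrec.const 2))
          (Primrec.const 1)) (Primrec.snd.comp Primrec.snd) (Primrec.const 1))).to_comp
    refine (UComputable.comp hf (UComputable.snd.pair ((UComputable.oracle UComputable.snd).pair
      (UComputable.oracle (UComputable.of_computable hw))))).of_eq ?_
    rintro ⟨⟨⟨e, X, β⟩, p⟩, hz⟩
    simp only at hz ⊢
    by_cases hp : OLe p.unpair.1 β
    · rw [if_neg (jumpIter_ne_zero.2 hp), zeroJump]
      rcases jumpIter_cases (fun _ => 0) hp with ⟨h0, hv⟩ | ⟨k, hk, hv⟩ | ⟨-, h0, hv⟩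
      · rw [hv, h0]; rfl
      · have h3 : succNote k % 2 = 1 := by simp only [succNote]; omega
        have h4 : OLe (Nat.pair p.unpair.1 (h (e, p.unpair.2))).unpair.1 β := by simpa using hp
        have hkβ : OLt k β := (oLt_succNote (hk ▸ hp.kleeneO_left)).trans_oLe (hk ▸ hp)
        rw [hv, if_pos (hk ▸ h3), jumpIter_of_oLe h4]
        simp only [Nat.unpair_pair, hk, jumpColumn_succNote]
        exact congrArg (· + 1) (hred e _ _ (hz k hkβ) _).symm
      · rw [hv, if_neg (by omega)]
    · rw [if_pos (not_not.1 (mt jumpIter_ne_zero.1 hp)), zeroJump,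
        not_not.1 (mt jumpIter_ne_zero.1 hp)]
  obtain ⟨c, hc⟩ := h1.exists_recursive
  refine ⟨c, fun X β => ?_⟩
  induction β using OLt.wellFounded.induction with
  | _ β ih =>
    intro hβ n
    exact hc ⟨((c, X, β), n), fun k hk => ih k hk (OLe.kleeneO_left hk.oLe)⟩ rfl

theorem UReal.zeroJump_of_jumpIter {ι α : Type*} [Primcodable α] {a : ι → α} {X : ι → ℕ → ℕ}
    {β : ι → ℕ} (hβ : ∀ i, KleeneO (β i)) :
    UReal (fun i => jumpIter (X i) (β i)) a fun i => zeroJump (β i) := by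
  obtain ⟨c, hc⟩ := exists_functional_zeroJump
  exact (UPartrec.functional (c := fun _ : ι × ℕ => c) (n := fun q => q.2) (UComputable.const c)
    UComputable.snd).of_eq fun q => hc _ _ (hβ _) _

theorem tRed_jumpIter_self {g : ℕ → ℕ} {β : ℕ} (hβ : KleeneO β) : TRed g (jumpIter g β) := by
  have h1 : UReal (fun _ : Unit => jumpIter g β) (fun _ => ()) fun _ => g := by
    have h2 : Computable fun z : Unit × ℕ => Nat.pair 0 z.2 :=
      (Primrec₂.natPair.comp (Primrec.const 0) Primrec.snd).to_comp
    have h3 : UComputable (fun _ : Unit × ℕ => jumpIter g β) (fun q => ((), q.2))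
        fun q => jumpIter g β (Nat.pair 0 q.2) :=
      UComputable.oracle (UComputable.of_computable h2)
    refine (UComputable.comp Computable.pred h3).of_eq fun q => ?_
    rw [jumpIter_of_oLe (by simpa using zero_oLe hβ)]
    simp [jumpColumn_zero]
  exact h1.tRed ()

theorem tRed_zeroJump_of_oLe {k β : ℕ} (h : OLe k β) : TRed (zeroJump k) (zeroJump β) :=
  (UReal.jumpIter_of_oLe (X := fun _ : Unit => fun _ => 0) (k := fun _ => k) fun _ => h).tRed ()

/-! ### Strings and expansionary functions -/

theorem InitSeg.of_prefix {σ τ : List ℕ} {g : ℕ → ℕ} (h : σ <+: τ) (hτ : InitSeg τ g) :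
    InitSeg σ g := by
  rw [InitSeg] at hτ ⊢
  rw [List.prefix_iff_eq_take] at h
  rw [← hτ, take_restr, min_eq_left (by rw [h]; simp)] at h
  exact h.symm

theorem InitSeg.prefix_of_length_le {σ τ : List ℕ} {g : ℕ → ℕ} (hσ : InitSeg σ g)
    (hτ : InitSeg τ g) (h : σ.length ≤ τ.length) : σ <+: τ := by
  rw [← hσ, ← hτ]
  exact restr_prefix g h

theorem InitSeg.comparable {σ τ : List ℕ} {g : ℕ → ℕ} (hσ : InitSeg σ g) (hτ : InitSeg τ g) :
    σ <+: τ ∨ τ <+: σ :=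
  (le_total σ.length τ.length).imp (hσ.prefix_of_length_le hτ) (hτ.prefix_of_length_le hσ)

theorem initSeg_restr (g : ℕ → ℕ) (n : ℕ) : InitSeg (restr g n) g := by simp [InitSeg]

theorem InitSeg.getD {σ : List ℕ} {g : ℕ → ℕ} (h : InitSeg σ g) {n : ℕ} (hn : n < σ.length) :
    σ.getD n 0 = g n := by
  rw [← h, List.getD_eq_getElem?_getD, getElem?_restr, if_pos hn, Option.getD_some]

theorem leftOf_or_leftOf_of_incompat {σ τ : List ℕ} (h : Incompat σ τ) :
    LeftOf σ τ ∨ LeftOf τ σ := by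
  induction σ generalizing τ with
  | nil => exact absurd (List.nil_prefix) h.1
  | cons a σ ih =>
    cases τ with
    | nil => exact absurd (List.nil_prefix) h.2
    | cons b τ =>
      rcases lt_trichotomy a b with hab | rfl | hab
      · exact Or.inl ⟨[], a, b, hab, by simp, by simp⟩
      · have h' : Incompat σ τ := by
          simpa only [Incompat, List.cons_prefix_cons, true_and] using h
        refine (ih h').imp ?_ ?_ <;>
        · rintro ⟨ρ, x, y, hxy, h1, h2⟩
          exact ⟨a :: ρ, x, y, hxy, by simpa using h1, by simpa using h2⟩
      · exact Or.inr ⟨[], b, a, hab, by simp, by simp⟩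

theorem LeftOf.not_common_extension {σ τ υ : List ℕ} (h : LeftOf σ τ) (hσ : σ <+: υ)
    (hτ : τ <+: υ) : False := by
  obtain ⟨ρ, x, y, hxy, h1, h2⟩ := h
  have h3 := List.prefix_of_prefix_length_le (h1.trans hσ) (h2.trans hτ) (by simp)
  have h4 := h3.eq_of_length (by simp)
  simp at h4
  omega

namespace Expansionary

variable {D : Set (List ℕ)} {Γ : List ℕ → List ℕ}

theorem map_prefix (h : Expansionary D Γ) {σ τ : List ℕ} (hσ : σ ∈ D) (hτ : τ ∈ D)
    (hστ : σ <+: τ) : Γ σ <+: Γ τ := by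
  by_cases he : σ = τ
  · rw [he]
  · exact ((h.monotone σ hσ τ hτ).1 ⟨hστ, he⟩).1

theorem prefix_of_map_prefix (h : Expansionary D Γ) {σ τ : List ℕ} (hσ : σ ∈ D) (hτ : τ ∈ D)
    (hΓ : Γ σ <+: Γ τ) : σ <+: τ := by
  by_contra hn
  by_cases hτσ : τ <+: σ
  · have h1 := (h.monotone τ hτ σ hσ).1 ⟨hτσ, fun he => hn (he ▸ List.prefix_rfl)⟩
    exact h1.2 (h1.1.eq_of_length_le hΓ.length_le)
  · rcases leftOf_or_leftOf_of_incompat ⟨hn, hτσ⟩ with h1 | h1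
    · exact (h.leftOf σ hσ τ hτ h1).not_common_extension hΓ List.prefix_rfl
    · exact (h.leftOf τ hτ σ hσ h1).not_common_extension List.prefix_rfl hΓ

end Expansionary

namespace TreeTower

variable {𝒯 : TreeTower}

theorem mem_of_oLe {β γ : ℕ} (hγ : γ ∈ 𝒯.I) (h : OLe β γ) : β ∈ 𝒯.I := by
  rcases h.eq_or_oLt with rfl | h
  · exact hγ
  · exact 𝒯.path.downward γ hγ β h

theorem mem_nonMax_of_oLt {β γ : ℕ} (hγ : γ ∈ 𝒯.I) (h : OLt β γ) : β ∈ 𝒯.nonMax :=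
  ⟨mem_of_oLe hγ h.oLe, γ, hγ, h⟩

theorem mem_nonMax_of_oLe {β γ : ℕ} (hγ : γ ∈ 𝒯.nonMax) (h : OLe β γ) : β ∈ 𝒯.nonMax := by
  obtain ⟨δ, hδ, hγδ⟩ := hγ.2
  exact mem_nonMax_of_oLt hδ (h.trans_oLt hγδ)

theorem map_mem_of_oLe {β γ : ℕ} (hγ : γ ∈ 𝒯.I) (h : OLe β γ) {σ : List ℕ} (hσ : σ ∈ 𝒯.T γ) :
    𝒯.Γ γ β σ ∈ 𝒯.T β := by
  rcases h.eq_or_oLt with rfl | h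
  · rwa [𝒯.map_self β hγ σ hσ]
  · exact 𝒯.map_mem γ hγ β h σ hσ

theorem map_prefix_iff {β γ : ℕ} (hγ : γ ∈ 𝒯.I) (h : OLe β γ) {σ τ : List ℕ} (hσ : σ ∈ 𝒯.T γ)
    (hτ : τ ∈ 𝒯.T γ) : 𝒯.Γ γ β σ <+: 𝒯.Γ γ β τ ↔ σ <+: τ := by
  rcases h.eq_or_oLt with rfl | h
  · rw [𝒯.map_self β hγ σ hσ, 𝒯.map_self β hγ τ hτ]
  · have he := 𝒯.map_expansionary γ hγ β h
    exact ⟨he.prefix_of_map_prefix hσ hτ, he.map_prefix hσ hτ⟩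

theorem map_comp_of_oLe {β γ δ : ℕ} (hδ : δ ∈ 𝒯.I) (h1 : OLe β γ) (h2 : OLe γ δ) {σ : List ℕ}
    (hσ : σ ∈ 𝒯.T δ) : 𝒯.Γ δ β σ = 𝒯.Γ γ β (𝒯.Γ δ γ σ) := by
  rcases h2.eq_or_oLt with rfl | h2
  · rw [𝒯.map_self γ hδ σ hσ]
  · rcases h1.eq_or_oLt with rfl | h1
    · rw [𝒯.map_self β (mem_of_oLe hδ h2.oLe) _ (𝒯.map_mem δ hδ β h2 σ hσ)]
    · exact 𝒯.map_comp δ hδ γ β h2 h1 σ hσ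

theorem le_length_map {β γ : ℕ} (hγ : γ ∈ 𝒯.I) (h : OLe β γ) {f : ℕ → ℕ}
    (hf : f ∈ treePaths (𝒯.T γ)) (n : ℕ) : n ≤ (𝒯.Γ γ β (restr f n)).length := by
  induction n with
  | zero => exact Nat.zero_le _
  | succ n ih =>
    have h1 := (map_prefix_iff hγ h (hf n) (hf (n + 1))).2 (restr_prefix f (Nat.le_succ n))
    by_contra hlt
    have h2 := h1.eq_of_length_le (by omega)
    have h3 := ((map_prefix_iff hγ h (hf (n + 1)) (hf n)).1 (h2 ▸ List.prefix_rfl)).length_le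
    simp at h3

theorem map_restr_getD {β γ : ℕ} (hγ : γ ∈ 𝒯.I) (h : OLe β γ) {f g : ℕ → ℕ}
    (hf : f ∈ treePaths (𝒯.T γ)) (hfg : SendsPath (𝒯.Γ γ β) f g) (n : ℕ) :
    (𝒯.Γ γ β (restr f (n + 1))).getD n 0 = g n :=
  (hfg (n + 1)).getD (le_length_map hγ h hf (n + 1))

/-- A path `f` that is sent to `g` extends every string of `T γ` whose image is an initial segment
of `g`, because incompatible strings have incompatible images. -/
theorem eq_restr_of_initSeg_map {β γ : ℕ} (hγ : γ ∈ 𝒯.I) (h : OLe β γ) {f g : ℕ → ℕ}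
    (hf : f ∈ treePaths (𝒯.T γ)) (hfg : SendsPath (𝒯.Γ γ β) f g) {σ : List ℕ} (hσ : σ ∈ 𝒯.T γ)
    (hσg : InitSeg (𝒯.Γ γ β σ) g) : σ = restr f σ.length := by
  rcases hσg.comparable (hfg σ.length) with h1 | h1
  · exact ((map_prefix_iff hγ h hσ (hf _)).1 h1).eq_of_length (by simp)
  · exact (((map_prefix_iff hγ h (hf _) hσ).1 h1).eq_of_length (by simp)).symm

/-! ### Lifts of paths -/

theorem exists_sendsPath {β γ : ℕ} (hγ : γ ∈ 𝒯.I) (h : OLe β γ) {f : ℕ → ℕ}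
    (hf : f ∈ treePaths (𝒯.T γ)) : ∃ g ∈ treePaths (𝒯.T β), SendsPath (𝒯.Γ γ β) f g := by
  rcases h.eq_or_oLt with rfl | h
  · exact ⟨f, hf, fun n => by rw [𝒯.map_self β hγ _ (hf n)]; exact initSeg_restr f n⟩
  · obtain ⟨e, he⟩ := 𝒯.map_homeo γ hγ β h
    exact ⟨(e ⟨f, hf⟩).1, (e ⟨f, hf⟩).2, he ⟨f, hf⟩⟩

theorem exists_isLift {β : ℕ} (hβ : β ∈ 𝒯.I) {g : ℕ → ℕ} (hg : g ∈ 𝒯.rootPaths) :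
    ∃ f, 𝒯.IsLift β g f := by
  rcases (zero_oLe (𝒯.path.subset β hβ)).eq_or_oLt with rfl | h
  · exact ⟨g, hg, fun n => by rw [𝒯.map_self 0 hβ _ (hg n)]; exact initSeg_restr g n⟩
  · obtain ⟨e, he⟩ := 𝒯.map_homeo β hβ 0 h
    refine ⟨(e.symm ⟨g, hg⟩).1, (e.symm ⟨g, hg⟩).2, ?_⟩
    simpa using he (e.symm ⟨g, hg⟩)

theorem IsLift.root_unique {β : ℕ} (hβ : β ∈ 𝒯.I) {f g g' : ℕ → ℕ} (h : 𝒯.IsLift β g f)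
    (h' : 𝒯.IsLift β g' f) : g = g' := by
  have h0 := zero_oLe (𝒯.path.subset β hβ)
  funext n
  rw [← map_restr_getD hβ h0 h.1 h.2, map_restr_getD hβ h0 h.1 h'.2]

/-- If `f` lifts `g` to the level `γ`, then its image at a level `β ≤ γ` is the lift to `β`. -/
theorem IsLift.of_sendsPath {β γ : ℕ} (hγ : γ ∈ 𝒯.I) (h : OLe β γ) {f f' g : ℕ → ℕ}
    (hf : 𝒯.IsLift γ g f) (hf' : f' ∈ treePaths (𝒯.T β)) (hff' : SendsPath (𝒯.Γ γ β) f f') :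
    𝒯.IsLift β g f' := by
  have hβ := mem_of_oLe hγ h
  have h0 := zero_oLe (𝒯.path.subset β hβ)
  refine ⟨hf', fun n => ?_⟩
  have h1 : restr f' n <+: 𝒯.Γ γ β (restr f n) :=
    (initSeg_restr f' n).prefix_of_length_le (hff' n) (by simpa using le_length_map hγ h hf.1 n)
  have h2 := (map_prefix_iff hβ h0 (hf' n) (map_mem_of_oLe hγ h (hf.1 n))).2 h1
  rw [← map_comp_of_oLe hγ h0 h (hf.1 n)] at h2
  exact (hf.2 n).of_prefix h2

section Computability

variable {ι : Type*}

theorem uDecidable_mem {β : ι → ℕ} {σ : ι → List ℕ} (hβ : ∀ i, β i ∈ 𝒯.I) :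
    UDecidable (fun i => zeroJump (β i)) (fun i => (β i, σ i)) fun i => σ i ∈ 𝒯.T (β i) := by
  classical
  obtain ⟨c, hc⟩ := 𝒯.tree_computable
  have h1 : UComputable (fun i => zeroJump (β i)) (fun i => (β i, σ i))
      fun i => if σ i ∈ 𝒯.T (β i) then 1 else 0 := by
    refine (UPartrec.functional (UComputable.const c) (UComputable.comp₂
      Primrec₂.natPair.to_comp UComputable.fst (UComputable.comp Computable.encode
        UComputable.snd))).of_eq fun i => ?_
    obtain ⟨v, hv, h⟩ := hc (β i) (hβ i) (σ i)
    rw [hv]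
    rcases h with ⟨rfl, h⟩ | ⟨rfl, h⟩ <;> simp [h]
  exact (UDecidable.eq h1 (UComputable.const 1)).of_iff fun i => by simp

theorem uComputable_map {β γ : ι → ℕ} {σ : ι → List ℕ} (hγ : ∀ i, γ i ∈ 𝒯.I)
    (hβ : ∀ i, OLe (β i) (γ i)) (hσ : ∀ i, σ i ∈ 𝒯.T (γ i)) :
    UComputable (fun i => zeroJump (γ i)) (fun i => ((γ i, β i), σ i))
      fun i => 𝒯.Γ (γ i) (β i) (σ i) := by
  obtain ⟨c, hc⟩ := 𝒯.map_computable
  refine (UComputable.ite (f := σ) (g := fun i => 𝒯.Γ (γ i) (β i) (σ i))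
    (UDecidable.eq (f := β) (g := γ) (UComputable.comp Computable.snd UComputable.fst)
      (UComputable.comp Computable.fst UComputable.fst)) UComputable.snd ?_).of_eq fun i => ?_
  · have h1 : UComputable (fun i : {i // ¬ β i = γ i} => zeroJump (γ i))
        (fun i => ((γ i, β i), σ i)) fun i => Encodable.encode (𝒯.Γ (γ i) (β i) (σ i)) := by
      refine (UPartrec.functional (UComputable.const c) (UComputable.comp₂
        Primrec₂.natPair.to_comp (UComputable.comp (h := fun p : ℕ × ℕ => Nat.pair p.1 p.2)
          Primrec₂.natPair.to_comp UComputable.fst) (UComputable.comp Computable.encode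
            UComputable.snd))).of_eq fun i => ?_
      exact hc _ (hγ i) _ ((hβ i).eq_or_oLt.resolve_left i.2) _ (hσ i)
    exact (UComputable.comp (Computable.ofNat (List ℕ)) h1).of_eq fun i => by simp
  · split_ifs with h
    · rw [h, 𝒯.map_self _ (hγ i) _ (hσ i)]
    · rfl

/-- The lift `g^β` is computable from `0^(β) ⊕ g`, uniformly in `β` and `g`. -/
theorem uReal_lift {β : ι → ℕ} {f g : ι → ℕ → ℕ} (hβ : ∀ i, β i ∈ 𝒯.I)
    (hf : ∀ i, 𝒯.IsLift (β i) (g i) (f i)) :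
    UReal (fun i => join (zeroJump (β i)) (g i)) β f := by
  have h0 : ∀ i, OLe 0 (β i) := fun i => zero_oLe (𝒯.path.subset _ (hβ i))
  have hg : UDecidable (fun z : {z : (ι × ℕ) × List ℕ // z.2 ∈ 𝒯.T (β z.1.1)} =>
        join (zeroJump (β z.1.1.1)) (g z.1.1.1)) (fun z => ((β z.1.1.1, z.1.1.2), z.1.2))
      fun z => restr (g z.1.1.1) (𝒯.Γ (β z.1.1.1) 0 z.1.2).length = 𝒯.Γ (β z.1.1.1) 0 z.1.2 := by
    have h1 : UComputable (fun z : {z : (ι × ℕ) × List ℕ // z.2 ∈ 𝒯.T (β z.1.1)} =>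
        join (zeroJump (β z.1.1.1)) (g z.1.1.1)) (fun z => ((β z.1.1.1, z.1.1.2), z.1.2))
        fun z => 𝒯.Γ (β z.1.1.1) 0 z.1.2 := by
      refine UComputable.cut (UComputable.pair (UComputable.pair (UComputable.comp Computable.fst
        UComputable.fst) (UComputable.const 0)) UComputable.snd)
        (UComputable.changeOracle UReal.join_left ?_)
      exact uComputable_map (β := fun _ => 0) (fun z => hβ _) (fun z => h0 _) fun z => z.2
    exact UDecidable.eq (UReal.restr UReal.join_right (UComputable.comp Computable.list_length h1))
      h1
  have hP : UDecidable (fun q : (ι × ℕ) × List ℕ => join (zeroJump (β q.1.1)) (g q.1.1))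
      (fun q => ((β q.1.1, q.1.2), q.2)) fun q => (q.2 ∈ 𝒯.T (β q.1.1) ∧
        InitSeg (𝒯.Γ (β q.1.1) 0 q.2) (g q.1.1)) ∧ q.2.length = q.1.2 + 1 := by
    refine UDecidable.and (UDecidable.and_of ?_ hg) ?_
    · exact UComputable.cut (UComputable.pair (UComputable.comp Computable.fst UComputable.fst)
        UComputable.snd) (UComputable.changeOracle UReal.join_left
          (uDecidable_mem fun q => hβ q.1.1))
    · exact UDecidable.eq (UComputable.comp Computable.list_length UComputable.snd)
        (UComputable.comp Computable.succ (UComputable.comp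
          (f := fun q : (ι × ℕ) × List ℕ => (β q.1.1, q.1.2)) Computable.snd UComputable.fst))
  obtain ⟨σ, hσ, hσ'⟩ := UDecidable.search (O := fun q : ι × ℕ => join (zeroJump (β q.1)) (g q.1))
    (a := fun q => (β q.1, q.2)) hP fun q => ⟨restr (f q.1) (q.2 + 1),
    ⟨(hf q.1).1 _, (hf q.1).2 _⟩, by simp⟩
  refine (UComputable.comp₂ (Primrec.list_getD 0).to_comp hσ UComputable.snd).of_eq fun q => ?_
  have h1 := eq_restr_of_initSeg_map (hβ q.1) (h0 _) (hf q.1).1 (hf q.1).2 (hσ' q).1.1 (hσ' q).1.2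
  simp only [(hσ' q).2] at h1
  rw [h1]
  exact (initSeg_restr _ _).getD (by simp)

/-- A path `g` through the root is computable from `0^(β) ⊕ g^β`, uniformly in `β` and `g`. -/
theorem uReal_root {β : ι → ℕ} {f g : ι → ℕ → ℕ} (hβ : ∀ i, β i ∈ 𝒯.I)
    (hf : ∀ i, 𝒯.IsLift (β i) (g i) (f i)) :
    UReal (fun i => join (zeroJump (β i)) (f i)) β g := by
  have h0 : ∀ i, OLe 0 (β i) := fun i => zero_oLe (𝒯.path.subset _ (hβ i))
  have h1 : UComputable (fun q : ι × ℕ => join (zeroJump (β q.1)) (f q.1))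
      (fun q => (β q.1, q.2)) fun q => 𝒯.Γ (β q.1) 0 (restr (f q.1) (q.2 + 1)) := by
    refine UComputable.cut (UComputable.pair (UComputable.pair UComputable.fst
      (UComputable.const 0)) (UReal.restr UReal.join_right
        (UComputable.comp Computable.succ UComputable.snd)))
      (UComputable.changeOracle UReal.join_left ?_)
    exact uComputable_map (β := fun _ => 0) (fun q => hβ q.1) (fun q => h0 q.1)
      fun q => (hf q.1).1 _
  refine (UComputable.comp₂ (Primrec.list_getD 0).to_comp h1 UComputable.snd).of_eq fun q => ?_
  exact map_restr_getD (hβ q.1) (h0 q.1) (hf q.1).1 (hf q.1).2 q.2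

/-! ### Transfinite jumps of paths -/

/-- The successor step: an index for `g^(k)` relative to `0^(k) ⊕ g` is turned into a computation
of the next jump from `0^(k+1) ⊕ g`, by way of the jump of `0^(k) ⊕ g^k`. -/
theorem IsSubgeneric.uComputable_turingJump (h𝒯 : 𝒯.IsSubgeneric) {e : ι → Code} {k x : ι → ℕ}
    {g : ι → ℕ → ℕ} (hk : ∀ i, succNote (k i) ∈ 𝒯.I) (hg : ∀ i, g i ∈ 𝒯.rootPaths)
    (he : ∀ i n, functional (e i) (join (zeroJump (k i)) (g i)) n =
      Part.some (jumpIter (g i) (k i) n)) :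
    UComputable (fun i => join (zeroJump (succNote (k i))) (g i)) (fun i => ((e i, k i), x i))
      fun i => turingJump (jumpIter (g i) (k i)) (x i) := by
  obtain ⟨h, hh, hred⟩ := exists_turingJump_reduction
  obtain ⟨c, hc⟩ := h𝒯.jump
  have hlt : ∀ i, OLt (k i) (succNote (k i)) := fun i => oLt_succNote (𝒯.path.subset _ (hk i))
  have hk' : ∀ i, k i ∈ 𝒯.nonMax := fun i => mem_nonMax_of_oLt (hk i) (hlt i)
  choose f hf using fun i => exists_isLift (hk' i).1 (hg i)
  choose f' hf' using fun i => exists_isLift (hk i) (hg i)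
  have h1 : UComputable (fun q : ι × ℕ => join (zeroJump (k q.1)) (f q.1))
      (fun q => ((e q.1, k q.1), q.2)) fun q => jumpIter (g q.1) (k q.1) q.2 := by
    have h2 : UReal (fun q : ι × ℕ => join (zeroJump (k q.1)) (f q.1))
        (fun q => ((e q.1, k q.1), q.2)) fun q => join (zeroJump (k q.1)) (g q.1) :=
      UReal.join UReal.join_left (UReal.cut (UComputable.comp Computable.snd UComputable.fst)
        (uReal_root (fun q => (hk' q.1).1) fun q => hf q.1))
    exact (UPartrec.functional_real (c := fun q : ι × ℕ => e q.1) (n := fun q => q.2) h2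
      (UComputable.comp Computable.fst UComputable.fst)
      UComputable.snd).of_eq fun q => he q.1 q.2
  obtain ⟨s, hs, hs'⟩ := UPartrec.smn h1
  have h3 : UReal (fun i => join (zeroJump (succNote (k i))) (g i))
      (fun i => ((e i, k i), x i)) fun i => join (zeroJump (succNote (k i))) (f' i) := by
    have h4 : Computable succNote := (Primrec.succ.comp (Primrec.nat_mul.comp (Primrec.const 2)
      Primrec.id)).to_comp
    refine UReal.join UReal.join_left (UReal.cut (UComputable.comp h4 (UComputable.comp
      Computable.snd UComputable.fst)) (uReal_lift hk hf'))
  have h5 : UComputable (fun i => join (zeroJump (succNote (k i))) (g i))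
      (fun i => ((e i, k i), x i)) fun i => Nat.pair (k i) (h (s (e i, k i), x i)) :=
    UComputable.comp₂ Primrec₂.natPair.to_comp (UComputable.comp Computable.snd UComputable.fst)
      (UComputable.comp hh ((UComputable.comp hs UComputable.fst).pair UComputable.snd))
  refine (UPartrec.functional_real (c := fun _ => c) h3 (UComputable.const c) h5).of_eq fun i => ?_
  have h6 : turingJump (jumpIter (g i) (k i)) (x i) =
      turingJump (join (zeroJump (k i)) (f i)) (h (s (e i, k i), x i)) :=
    hred (s (e i, k i)) _ _ (fun n => hs' (i, n)) (x i)
  simp only [h6]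
  exact hc (k i) (hk' i) (g i) (hg i) (f i) (f' i) (hf i) (hf' i) _

/-- One functional computes `g^(β)` from `0^(β) ⊕ g`, for all levels `β` of the tower and all paths
`g` through the root. By the recursion theorem it may refer to its own index for the levels below
`β`. -/
theorem IsSubgeneric.exists_functional_jumpIter (h𝒯 : 𝒯.IsSubgeneric) : ∃ c : Code,
    ∀ β ∈ 𝒯.I, ∀ g ∈ 𝒯.rootPaths, ∀ n,
      functional c (join (zeroJump β) g) n = Part.some (jumpIter g β n) := by
  classical
  -- contexts: an index `e` which is correct below `β`, a path `g`, and an argument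
  let ι := {z : (Code × (ℕ → ℕ) × ℕ) × ℕ // z.1.2.1 ∈ 𝒯.rootPaths ∧ z.1.2.2 ∈ 𝒯.I ∧
    ∀ k, OLt k z.1.2.2 → ∀ n, functional z.1.1 (join (zeroJump k) z.1.2.1) n =
      Part.some (jumpIter z.1.2.1 k n)}
  let O : ι → ℕ → ℕ := fun z => join (zeroJump z.1.1.2.2) z.1.1.2.1
  let a : ι → Code × ℕ := fun z => (z.1.1.1, z.1.2)
  have hγ {κ : Type} (r : κ → ι) : UComputable (fun j => O (r j)) (fun j => a (r j))
      fun j => (r j).1.2.unpair.1 :=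
    UComputable.comp (Computable.fst.comp Computable.unpair) UComputable.snd
  have hx {κ : Type} (r : κ → ι) : UComputable (fun j => O (r j)) (fun j => a (r j))
      fun j => (r j).1.2.unpair.2 :=
    UComputable.comp (Computable.snd.comp Computable.unpair) UComputable.snd
  have hmod : Computable fun n : ℕ => n % 2 :=
    (Primrec.nat_mod.comp Primrec.id (Primrec.const 2)).to_comp
  have hdiv : Computable fun n : ℕ => n / 2 :=
    (Primrec.nat_div.comp Primrec.id (Primrec.const 2)).to_comp
  have hsucc : ∀ z : {z : ι // zeroJump z.1.1.2.2 z.1.2 ≠ 0 ∧ z.1.2.unpair.1 % 2 = 1},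
      OLe (succNote (z.1.1.2.unpair.1 / 2)) z.1.1.1.2.2 := fun z => by
    have h1 : succNote (z.1.1.2.unpair.1 / 2) = z.1.1.2.unpair.1 := by
      have := z.2.2
      simp only [succNote]; omega
    rw [h1]
    exact jumpIter_ne_zero.1 z.2.1
  have hjump : UComputable
      (fun z : {z : ι // zeroJump z.1.1.2.2 z.1.2 ≠ 0 ∧ z.1.2.unpair.1 % 2 = 1} => O z)
      (fun z => a z) fun z =>
        turingJump (jumpIter z.1.1.1.2.1 (z.1.1.2.unpair.1 / 2)) z.1.1.2.unpair.2 + 1 := by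
    have h1 := UComputable.comp hdiv (hγ (Subtype.val :
      {z : ι // zeroJump z.1.1.2.2 z.1.2 ≠ 0 ∧ z.1.2.unpair.1 % 2 = 1} → ι))
    have h4 : Computable succNote := (Primrec.succ.comp (Primrec.nat_mul.comp (Primrec.const 2)
      Primrec.id)).to_comp
    refine UComputable.comp Computable.succ (UComputable.cut
      ((UComputable.fst.pair h1).pair (hx Subtype.val))
      (UComputable.changeOracle (Y := fun z => join (zeroJump (succNote (z.1.1.2.unpair.1 / 2)))
        z.1.1.1.2.1) ?_ (h𝒯.uComputable_turingJump (fun z => mem_of_oLe z.1.2.2.1 (hsucc z))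
        (fun z => z.1.2.1) fun z n => z.1.2.2.2 _ ?_ n)))
    · exact UReal.join (UReal.trans UReal.join_left (UReal.cut (UComputable.comp h4
        (UComputable.comp Computable.snd UComputable.fst)) (UReal.jumpIter_of_oLe hsucc)))
        UReal.join_right
    · exact (oLt_succNote (hsucc z).kleeneO_left).trans_oLe (hsucc z)
  have hv : UComputable O a fun z => zeroJump z.1.1.2.2 z.1.2 :=
    UReal.app UReal.join_left UComputable.snd
  have hroot : UComputable O a fun z =>
      if z.1.2.unpair.1 = 0 then z.1.1.2.1 z.1.2.unpair.2 + 1 else 1 :=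
    UComputable.ite (f := fun z : ι => z.1.1.2.1 z.1.2.unpair.2 + 1) (g := fun _ => 1)
      (UDecidable.eq (hγ id) (UComputable.const 0))
      (UComputable.comp Computable.succ (UReal.app UReal.join_right (hx Subtype.val)))
      (UComputable.const 1)
  have hz : UDecidable O a fun z => zeroJump z.1.1.2.2 z.1.2 ≠ 0 :=
    (UDecidable.eq hv (UComputable.const 0)).not
  have hodd : UDecidable O a fun z => z.1.2.unpair.1 % 2 = 1 :=
    UDecidable.eq (UComputable.comp hmod (hγ id)) (UComputable.const 1)
  have hrest : UComputable O a fun z => if zeroJump z.1.1.2.2 z.1.2 ≠ 0 then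
      (if z.1.2.unpair.1 = 0 then z.1.1.2.1 z.1.2.unpair.2 + 1 else 1) else 0 :=
    UComputable.ite (f := fun z : ι =>
      if z.1.2.unpair.1 = 0 then z.1.1.2.1 z.1.2.unpair.2 + 1 else 1) (g := fun _ => 0) hz
      (hroot.reindex Subtype.val) (UComputable.const 0)
  have hF : UComputable O a fun z : ι => jumpIter z.1.1.2.1 z.1.1.2.2 z.1.2 := by
    refine (UComputable.ite (f := fun z : ι =>
        turingJump (jumpIter z.1.1.2.1 (z.1.2.unpair.1 / 2)) z.1.2.unpair.2 + 1)
      (g := fun z : ι => if zeroJump z.1.1.2.2 z.1.2 ≠ 0 then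
        (if z.1.2.unpair.1 = 0 then z.1.1.2.1 z.1.2.unpair.2 + 1 else 1) else 0)
      (hz.and hodd) hjump (hrest.reindex Subtype.val)).of_eq ?_
    rintro ⟨⟨⟨e, g, β⟩, p⟩, hz⟩
    simp only at hz ⊢
    have hne : zeroJump β p ≠ 0 ↔ OLe p.unpair.1 β := jumpIter_ne_zero
    simp only [hne]
    by_cases hp : OLe p.unpair.1 β
    · rcases jumpIter_cases g hp with ⟨h0, hv⟩ | ⟨k, hk, hv⟩ | ⟨h0, h0', hv⟩
      · rw [hv, if_neg (by omega), if_pos hp, if_pos h0]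
      · have h1 : succNote k % 2 = 1 := by simp only [succNote]; omega
        have h2 : succNote k / 2 = k := by simp only [succNote]; omega
        rw [hv, if_pos ⟨hp, hk ▸ h1⟩, hk, h2]
      · rw [hv, if_neg (by omega), if_pos hp, if_neg h0]
    · rw [if_neg fun h => hp h.1, if_neg hp, not_not.1 (mt jumpIter_ne_zero.1 hp)]
  obtain ⟨c, hc⟩ := UPartrec.exists_recursive hF
  refine ⟨c, fun β => ?_⟩
  induction β using OLt.wellFounded.induction with
  | _ β ih =>
    intro hβ g hg n
    exact hc ⟨((c, g, β), n), hg, hβ, fun k hk =>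
      ih k hk (mem_of_oLe hβ hk.oLe) g hg⟩ rfl

end Computability

end TreeTower

/-! ### Values of functionals on strings -/

theorem restr_join_getD {A f : ℕ → ℕ} {σ : List ℕ} (h : InitSeg σ f) {k : ℕ}
    (hk : k ≤ 2 * σ.length) :
    restr (join A fun i => σ.getD i 0) k = restr (join A f) k := by
  refine List.map_congr_left fun i hi => ?_
  have hi' := List.mem_range.1 hi
  simp only [join]
  split_ifs with h0
  · rfl
  · exact h.getD (by omega)

theorem StringValue.unique {c : Code} {A : ℕ → ℕ} {σ : List ℕ} {n y y' : ℕ}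
    (h : StringValue c A σ n y) (h' : StringValue c A σ n y') : y = y' := by
  obtain ⟨k, -, hk, hj⟩ := h
  obtain ⟨k', -, hk', hj'⟩ := h'
  rcases lt_trichotomy k k' with hlt | rfl | hlt
  · rw [hj' k hlt] at hk; simp at hk
  · rw [hk] at hk'; simpa using hk'
  · rw [hj k' hlt] at hk'; simp at hk'

theorem StringValue.functional_eq {c : Code} {A f : ℕ → ℕ} {σ : List ℕ} {n y : ℕ}
    (h : StringValue c A σ n y) (hσ : InitSeg σ f) : functional c (join A f) n = Part.some y := by
  obtain ⟨k, hk, hv, hj⟩ := h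
  rw [restr_join_getD hσ hk] at hv
  refine Part.eq_some_iff.2 (Part.mem_bind_iff.2 ⟨k, mem_natRfind.2 ⟨?_, fun j hjk => ?_⟩, ?_⟩)
  · exact (Part.mem_map_iff _).2 ⟨_, Code.evaln_sound hv, by simp⟩
  · have h1 := hj j hjk
    rw [restr_join_getD hσ (by omega)] at h1
    exact (Part.mem_map_iff _).2 ⟨_, Code.evaln_sound h1, by simp⟩
  · exact (Part.mem_map_iff _).2 ⟨_, Code.evaln_sound hv, by simp⟩

theorem exists_stringValue {c : Code} {A f : ℕ → ℕ} {n y : ℕ}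
    (h : functional c (join A f) n = Part.some y) :
    ∃ N, ∀ m ≥ N, StringValue c A (restr f m) n y := by
  obtain ⟨k, hk, hy⟩ := Part.mem_bind_iff.1 (Part.eq_some_iff.1 h)
  obtain ⟨hk1, hk2⟩ := mem_natRfind.1 hk
  obtain ⟨v, hv, hvy⟩ := (Part.mem_map_iff _).1 hy
  obtain ⟨v', hv', hv0⟩ := (Part.mem_map_iff _).1 hk1
  obtain rfl := Part.mem_unique hv hv'
  have hv1 : v = y + 1 := by
    have : v ≠ 0 := by simpa using hv0
    rw [← hvy, Nat.pred_eq_sub_one]; omega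
  obtain ⟨s, hs⟩ := Code.evaln_complete.1 hv
  have h1 : ∀ m ≤ k, ∃ N, ∀ j < m, 0 ∈ Code.evaln N c
      (Nat.pair (Encodable.encode (restr (join A f) j)) n) := by
    intro m
    induction m with
    | zero => exact fun _ => ⟨0, fun j hj => absurd hj (Nat.not_lt_zero _)⟩
    | succ m ih =>
      intro hm
      obtain ⟨N, hN⟩ := ih (by omega)
      obtain ⟨w, hw, hw0⟩ := (Part.mem_map_iff _).1 (hk2 m (by omega))
      have hw1 : w = 0 := by simpa using hw0
      obtain ⟨t, ht⟩ := Code.evaln_complete.1 (hw1 ▸ hw)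
      refine ⟨max N t, fun j hj => ?_⟩
      rcases Nat.lt_succ_iff_lt_or_eq.1 hj with hj | rfl
      · exact Code.evaln_mono (le_max_left _ _) (hN j hj)
      · exact Code.evaln_mono (le_max_right _ _) ht
  obtain ⟨N, hN⟩ := h1 k le_rfl
  refine ⟨max k (max s N), fun m hm => ⟨k, ?_, ?_, fun j hj => ?_⟩⟩
  · simp only [length_restr]; omega
  · rw [restr_join_getD (initSeg_restr f m) (by simp only [length_restr]; omega), length_restr]
    exact hv1 ▸ Code.evaln_mono (by omega) hs
  · rw [restr_join_getD (initSeg_restr f m) (by simp only [length_restr]; omega), length_restr]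
    exact Code.evaln_mono (by omega) (hN j hj)

/-- The string to which the functional with index `c` sends `σ` has the entry `y` at the place
`m`. -/
def ImageValue (c : Code) (A : ℕ → ℕ) (σ : List ℕ) (m y : ℕ) : Prop :=
  m < σ.length ∧ (∀ j < m, ∃ z, StringValue c A σ j z) ∧ StringValue c A σ m y

theorem exists_imageValue {c : Code} {A f X : ℕ → ℕ}
    (h : ∀ n, functional c (join A f) n = Part.some (X n)) (m : ℕ) :
    ∃ N, ∀ k ≥ N, ImageValue c A (restr f k) m (X m) := by
  choose N hN using fun n => exists_stringValue (h n)
  refine ⟨m + 1 + (Finset.range (m + 1)).sup N, fun k hk => ?_⟩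
  have h1 : ∀ j < m + 1, N j ≤ k := fun j hj =>
    (Finset.le_sup (f := N) (Finset.mem_range.2 hj)).trans (by omega)
  refine ⟨by simp only [length_restr]; omega, fun j hj => ⟨_, hN j k (h1 j (by omega))⟩,
    hN m k (h1 m (by omega))⟩

theorem StringImage.imageValue {c : Code} {A : ℕ → ℕ} {σ ρ : List ℕ} (h : StringImage c A σ ρ)
    {m : ℕ} (hm : m < ρ.length) : ImageValue c A σ m ρ[m] :=
  ⟨lt_of_lt_of_le hm h.1, fun j hj => ⟨_, h.2.1 j (hj.trans hm)⟩, h.2.1 m hm⟩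

theorem ImageValue.getElem?_eq {c : Code} {A : ℕ → ℕ} {σ ρ : List ℕ} {m y : ℕ}
    (hv : ImageValue c A σ m y) (h : StringImage c A σ ρ) : ρ[m]? = some y := by
  have hm : m < ρ.length := by
    by_contra hlt
    obtain ⟨z, hz⟩ : ∃ z, StringValue c A σ ρ.length z := by
      rcases (not_lt.1 hlt).eq_or_lt with he | he
      · exact ⟨y, he ▸ hv.2.2⟩
      · exact hv.2.1 _ he
    exact h.2.2 (lt_of_le_of_lt (not_lt.1 hlt) hv.1) z hz
  rw [List.getElem?_eq_getElem hm]
  exact congrArg some ((h.2.1 m hm).unique hv.2.2)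

theorem exists_stringImage (c : Code) (A : ℕ → ℕ) (σ : List ℕ) : ∃ ρ, StringImage c A σ ρ := by
  classical
  have hex : ∃ m, σ.length ≤ m ∨ ∀ y, ¬ StringValue c A σ m y := ⟨σ.length, Or.inl le_rfl⟩
  have hmin : ∀ j < Nat.find hex, j < σ.length ∧ ∃ y, StringValue c A σ j y := fun j hj => by
    have := Nat.find_min hex hj
    push Not at this
    exact this
  choose! v hv using fun j hj => (hmin j hj).2
  refine ⟨(List.range (Nat.find hex)).map v, ?_, fun n h => ?_, fun h => ?_⟩
  · simpa using Nat.find_min' hex (Or.inl le_rfl)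
  · have hn : n < Nat.find hex := by simpa using h
    simpa using hv n hn
  · have h1 : Nat.find hex < σ.length := by simpa using h
    simpa using (Nat.find_spec hex).resolve_left (not_le.2 h1)

theorem Incompat.exists_getElem_ne {ρ τ : List ℕ} (h : Incompat ρ τ) :
    ∃ m, ∃ h1 : m < ρ.length, ∃ h2 : m < τ.length, ρ[m] ≠ τ[m] := by
  rcases leftOf_or_leftOf_of_incompat h with ⟨υ, x, y, hxy, ⟨s, rfl⟩, ⟨t, rfl⟩⟩ |
    ⟨υ, x, y, hxy, ⟨s, rfl⟩, ⟨t, rfl⟩⟩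
  · exact ⟨υ.length, by simp, by simp, by simpa using hxy.ne⟩
  · exact ⟨υ.length, by simp, by simp, by simpa using hxy.ne'⟩

theorem incompat_of_getElem?_ne {ρ τ : List ℕ} {m x y : ℕ} (h1 : ρ[m]? = some x)
    (h2 : τ[m]? = some y) (hne : x ≠ y) : Incompat ρ τ := by
  obtain ⟨hm1, -⟩ := List.getElem?_eq_some_iff.1 h1
  obtain ⟨hm2, -⟩ := List.getElem?_eq_some_iff.1 h2
  constructor
  · rintro ⟨s, rfl⟩
    rw [List.getElem?_append_left hm1, h1] at h2
    exact hne (Option.some_injective _ h2)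
  · rintro ⟨s, rfl⟩
    rw [List.getElem?_append_left hm2, h2] at h1
    exact hne (Option.some_injective _ h1).symm

section

variable {ι α : Type*} [Primcodable α] {O : ι → ℕ → ℕ} {a : ι → α}

theorem UComputable.evaln {A : ι → ℕ → ℕ} (hA : UReal O a A) (c : Code) {σ : ι → List ℕ}
    {k n : ι → ℕ} (hσ : UComputable O a σ) (hk : UComputable O a k) (hn : UComputable O a n) :
    UComputable O a fun i => Code.evaln (σ i).length c
      (Nat.pair (Encodable.encode (restr (join (A i) fun j => (σ i).getD j 0) (k i))) (n i)) := by
  have h1 : UReal O a fun i j => (σ i).getD j 0 :=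
    UComputable.comp₂ (Primrec.list_getD 0).to_comp hσ.weaken UComputable.snd
  have h2 : Computable fun z : ℕ × ℕ => Code.evaln z.1 c z.2 :=
    (Code.primrec_evaln.comp (Primrec.pair (Primrec.pair Primrec.fst (Primrec.const c))
      Primrec.snd)).to_comp
  exact UComputable.comp h2 ((UComputable.comp Computable.list_length hσ).pair
    (UComputable.comp₂ Primrec₂.natPair.to_comp (UComputable.comp Computable.encode
      ((hA.join h1).restr hk)) hn))

/-- A bounded search for the first answer of a machine on a string is decidable, for a decidable
set `S` of answers. -/
theorem UDecidable.first_answer {A : ι → ℕ → ℕ} (hA : UReal O a A) (c : Code) {σ : ι → List ℕ}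
    {n : ι → ℕ} (hσ : UComputable O a σ) (hn : UComputable O a n) {S : ι × Option ℕ → Prop}
    (hS : UDecidable (fun q : ι × Option ℕ => O q.1) (fun q => (a q.1, q.2)) S) :
    UDecidable O a fun i => ∃ k ≤ 2 * (σ i).length,
      S (i, Code.evaln (σ i).length c
        (Nat.pair (Encodable.encode (restr (join (A i) fun j => (σ i).getD j 0) k)) (n i))) ∧
      ∀ j < k, Code.evaln (σ i).length c
        (Nat.pair (Encodable.encode (restr (join (A i) fun j => (σ i).getD j 0) j)) (n i)) =
          some 0 := by
  have hlen : Computable fun σ : List ℕ => 2 * σ.length + 1 :=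
    (Primrec.succ.comp (Primrec.nat_mul.comp (Primrec.const 2) Primrec.list_length)).to_comp
  refine (UDecidable.exists_lt (P := fun q : ι × ℕ => S (q.1, Code.evaln (σ q.1).length c
        (Nat.pair (Encodable.encode (restr (join (A q.1) fun j => (σ q.1).getD j 0) q.2))
          (n q.1))) ∧ ∀ j < q.2, Code.evaln (σ q.1).length c
        (Nat.pair (Encodable.encode (restr (join (A q.1) fun j => (σ q.1).getD j 0) j))
          (n q.1)) = some 0) (UDecidable.and ?_ ?_) (UComputable.comp hlen hσ)).of_iff fun i => ?_
  · exact (UComputable.fst.pair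
      (UComputable.evaln hA.weaken c hσ.weaken UComputable.snd hn.weaken)).cut
      (UComputable.reindex hS _)
  · exact UDecidable.forall_lt (P := fun r : (ι × ℕ) × ℕ => Code.evaln (σ r.1.1).length c
        (Nat.pair (Encodable.encode (restr (join (A r.1.1) fun j => (σ r.1.1).getD j 0) r.2))
          (n r.1.1)) = some 0) (UDecidable.eq (UComputable.evaln hA.weaken.weaken c
        hσ.weaken.weaken UComputable.snd hn.weaken.weaken) (UComputable.const _)) UComputable.snd
  · simp only [Nat.lt_succ_iff]

theorem UDecidable.imageValue {A : ι → ℕ → ℕ} (hA : UReal O a A) (c : Code) {σ : ι → List ℕ}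
    {m y : ι → ℕ} (hσ : UComputable O a σ) (hm : UComputable O a m) (hy : UComputable O a y) :
    UDecidable O a fun i => ImageValue c (A i) (σ i) (m i) (y i) := by
  refine UDecidable.and (UDecidable.of_primrec (p := fun p : ℕ × ℕ => p.1 < p.2) Primrec.nat_lt
    (hm.pair (UComputable.comp Computable.list_length hσ))) (UDecidable.and ?_ ?_)
  · refine UDecidable.forall_lt (P := fun q : ι × ℕ => ∃ z, StringValue c (A q.1) (σ q.1) q.2 z)
      ?_ hm
    refine (UDecidable.first_answer hA.weaken c hσ.weaken UComputable.snd
      (S := fun q => q.2 ≠ none ∧ q.2 ≠ some 0) (UDecidable.and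
        (UDecidable.eq UComputable.snd (UComputable.const _)).not
        (UDecidable.eq UComputable.snd (UComputable.const _)).not)).of_iff fun q => ?_
    constructor
    · rintro ⟨k, hk, ⟨h1, h2⟩, h3⟩
      obtain ⟨v, hv⟩ := Option.ne_none_iff_exists'.1 h1
      obtain ⟨z, rfl⟩ := Nat.exists_eq_succ_of_ne_zero (n := v) fun h0 => h2 (h0 ▸ hv)
      exact ⟨z, k, hk, hv, h3⟩
    · rintro ⟨z, k, hk, hv, h3⟩
      exact ⟨k, hk, ⟨fun h0 => Option.some_ne_none _ (hv.symm.trans h0), fun h0 =>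
        Nat.succ_ne_zero z (Option.some_injective _ (hv.symm.trans h0))⟩, h3⟩
  · exact UDecidable.first_answer hA c hσ hm (S := fun q => q.2 = some (y q.1 + 1))
      (UDecidable.eq UComputable.snd (UComputable.comp Computable.option_some
        (UComputable.comp Computable.succ hy.weaken)))

end

namespace TreeTower

variable {𝒯 : TreeTower}

/-! ### The meet clause -/

/-- If `T β` is not splitting over `f` for the functional that computes `X` from `f`, then all
computations on strings of `T β` which extend a suitable initial segment of `f` agree, and a search
for one of them computes `X`. -/
theorem tRed_of_not_splittingOver {β : ℕ} (hβ : β ∈ 𝒯.I) {c : Code} {f X : ℕ → ℕ}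
    (hf : f ∈ treePaths (𝒯.T β))
    (hX : ∀ n, functional c (join (zeroJump β) f) n = Part.some (X n))
    (hs : ¬ SplittingOver c (zeroJump β) (𝒯.image β β) f) : TRed X (zeroJump β) := by
  have himage : ∀ σ, σ ∈ 𝒯.T β → σ ∈ 𝒯.image β β := fun σ hσ =>
    ⟨σ, hσ, 𝒯.map_self β hβ σ hσ⟩
  simp only [SplittingOver, not_forall] at hs
  obtain ⟨n, hn⟩ := hs
  have hA {κ α : Type} [Primcodable α] (a : κ → α) :
      UReal (fun _ : κ => zeroJump β) a fun _ => zeroJump β := UReal.oracle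
  have hP : UDecidable (fun _ : ℕ × (List ℕ × ℕ) => zeroJump β) (fun q => (id q.1, q.2))
      fun q => q.2.1 ∈ 𝒯.T β ∧ (q.2.1.take n = restr f n ∧
        ImageValue c (zeroJump β) q.2.1 q.1 q.2.2) := by
    have hτ : UComputable (fun _ : ℕ × (List ℕ × ℕ) => zeroJump β) (fun q => (id q.1, q.2))
        fun q => q.2.1 := UComputable.comp Computable.fst UComputable.snd
    refine UDecidable.and ?_ (UDecidable.and ?_ ?_)
    · exact UComputable.cut (UComputable.pair (UComputable.const β) hτ)
        (uDecidable_mem (𝒯 := 𝒯) (β := fun _ => β) fun _ => hβ)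
    · exact UDecidable.eq (UComputable.comp₂ Primrec.list_take.to_comp (UComputable.const n) hτ)
        (UComputable.const _)
    · exact UDecidable.imageValue (hA _) c hτ UComputable.fst
        (UComputable.comp Computable.snd UComputable.snd)
  obtain ⟨r, hr, hr'⟩ := UDecidable.search (O := fun _ : ℕ => zeroJump β) (a := id) hP fun m => by
    obtain ⟨N, hN⟩ := exists_imageValue hX m
    exact ⟨(restr f (max n N), X m), hf _, by rw [take_restr, min_eq_left (le_max_left _ _)],
      hN _ (le_max_right _ _)⟩
  have hval : ∀ m, (r m).2 = X m := fun m => by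
    obtain ⟨h1, h2, h3⟩ := hr' m
    obtain ⟨N, hN⟩ := exists_imageValue hX m
    obtain ⟨ρ₀, h₀⟩ := exists_stringImage c (zeroJump β) (r m).1
    obtain ⟨ρ₁, h₁⟩ := exists_stringImage c (zeroJump β) (restr f (max n N))
    by_contra hne
    refine hn ⟨_, himage _ h1, _, himage _ (hf (max n N)), ?_, restr_prefix f (le_max_left _ _),
      ρ₀, ρ₁, h₀, h₁, incompat_of_getElem?_ne (h3.getElem?_eq h₀)
        ((hN _ (le_max_right _ _)).getElem?_eq h₁) hne⟩
    exact h2 ▸ List.take_prefix n (r m).1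
  have h1 : UReal (fun _ : Unit => zeroJump β) (fun _ => ()) fun _ => X :=
    UComputable.cut UComputable.snd ((UComputable.of_eq (UComputable.comp Computable.snd hr)
      hval).reindex fun q : Unit × ℕ => q.2)
  exact h1.tRed ()

/-- Splitting over a path at the bottom level `β` passes on to all levels of the tower that are not
maximal. -/
theorem IsSubgeneric.splittingOver_image (h𝒯 : 𝒯.IsSubgeneric) {β : ℕ} {c : Code} {f : ℕ → ℕ}
    (hf : f ∈ treePaths (𝒯.T β)) (hs : SplittingOver c (zeroJump β) (𝒯.image β β) f) {l : ℕ}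
    (hl : l ∈ 𝒯.nonMax) (h : OLe β l) : SplittingOver c (zeroJump β) (𝒯.image l β) f := by
  induction l using OLt.wellFounded.induction with
  | _ l ih =>
    rcases h.eq_or_oLt with rfl | h
    · exact hs
    · exact h𝒯.splitting l hl β h c f hf fun α hβα hαl =>
        ih α hαl (mem_nonMax_of_oLe hl hαl.oLe) hβα

/-- If the image of `T γ` in `T β` is splitting over the image `f'` of a path `f` for the functional that
computes `X` from `f'`, then `X` is not computable from `0^(γ)`: otherwise the strings in `T γ`
that give a wrong value of `X` are r.e. in `0^(γ)` and dense along `f`. -/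
theorem IsSubgeneric.not_tRed_of_splittingOver (h𝒯 : 𝒯.IsSubgeneric) {β γ : ℕ}
    (hγ : γ ∈ 𝒯.nonMax) (h : OLt β γ) {c : Code} {f f' X : ℕ → ℕ} (hf : f ∈ treePaths (𝒯.T γ))
    (hff' : SendsPath (𝒯.Γ γ β) f f')
    (hX : ∀ n, functional c (join (zeroJump β) f') n = Part.some (X n))
    (hs : SplittingOver c (zeroJump β) (𝒯.image γ β) f') : ¬ TRed X (zeroJump γ) := by
  intro hred
  let W : Set (List ℕ) := {τ | ∃ q : ℕ × ℕ, τ ∈ 𝒯.T γ ∧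
    ImageValue c (zeroJump β) (𝒯.Γ γ β τ) q.1 q.2 ∧ q.2 ≠ X q.1}
  have hP : UDecidable (fun _ : List ℕ × (ℕ × ℕ) => zeroJump γ) (fun q => (id q.1, q.2))
      fun q => q.1 ∈ 𝒯.T γ ∧ ImageValue c (zeroJump β) (𝒯.Γ γ β q.1) q.2.1 q.2.2 ∧
        q.2.2 ≠ X q.2.1 := by
    refine UDecidable.and_of ?_ ?_
    · exact UComputable.cut (UComputable.pair (UComputable.const γ) UComputable.fst)
        (uDecidable_mem (𝒯 := 𝒯) (β := fun _ => γ) fun _ => hγ.1)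
    · have hm : UComputable (fun _ : {q : List ℕ × (ℕ × ℕ) // q.1 ∈ 𝒯.T γ} => zeroJump γ)
          (fun q => (id q.1.1, q.1.2)) fun q => q.1.2.1 :=
        UComputable.comp Computable.fst UComputable.snd
      have hy : UComputable (fun _ : {q : List ℕ × (ℕ × ℕ) // q.1 ∈ 𝒯.T γ} => zeroJump γ)
          (fun q => (id q.1.1, q.1.2)) fun q => q.1.2.2 :=
        UComputable.comp Computable.snd UComputable.snd
      refine UDecidable.and (UDecidable.imageValue (tRed_zeroJump_of_oLe h.oLe).uReal c ?_ hm hy)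
        (UDecidable.eq hy (UReal.app hred.uReal hm)).not
      exact UComputable.cut (UComputable.pair (UComputable.const (γ, β)) UComputable.fst)
        (uComputable_map (𝒯 := 𝒯) (γ := fun _ => γ) (β := fun _ => β) (fun _ => hγ.1)
          (fun _ => h.oLe) fun q => q.2)
  obtain ⟨F, hF, hF'⟩ := UDecidable.semidecide (O := fun _ : List ℕ => zeroJump γ) (a := id) hP
  have hW : REIn (zeroJump γ) W := REIn.of_uPartrec hF fun σ => (hF' σ).symm
  obtain ⟨n, hn⟩ := h𝒯.generic γ hγ W hW f hf
  rcases hn with ⟨⟨m, y⟩, -, hv, hne⟩ | hn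
  · refine hne (Part.some_injective ?_)
    exact (hv.2.2.functional_eq (hff' n)).symm.trans (hX m)
  · have hfn : restr f' (𝒯.Γ γ β (restr f n)).length = 𝒯.Γ γ β (restr f n) := hff' n
    obtain ⟨_, ⟨τ₀, hτ₀, rfl⟩, _, ⟨τ₁, hτ₁, rfl⟩, h₀, h₁, ρ₀, ρ₁, hρ₀, hρ₁, hinc⟩ :=
      hs (𝒯.Γ γ β (restr f n)).length
    rw [hfn, map_prefix_iff hγ.1 h.oLe (hf n) hτ₀] at h₀
    rw [hfn, map_prefix_iff hγ.1 h.oLe (hf n) hτ₁] at h₁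
    obtain ⟨m, hm₀, hm₁, hne⟩ := hinc.exists_getElem_ne
    by_cases hXm : ρ₀[m] = X m
    · exact hn τ₁ h₁ ⟨⟨(m, ρ₁[m]), hτ₁, hρ₁.imageValue hm₁,
        fun h' => hne (hXm.trans h'.symm)⟩, hτ₁⟩
    · exact hn τ₀ h₀ ⟨⟨(m, ρ₀[m]), hτ₀, hρ₀.imageValue hm₀, hXm⟩, hτ₀⟩

/-! ### The clauses of subgenericity -/

theorem IsLift.tRed_join {β : ℕ} (hβ : β ∈ 𝒯.I) {f g : ℕ → ℕ} (hf : 𝒯.IsLift β g f) :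
    TRed f (join (zeroJump β) g) :=
  (uReal_lift (ι := Unit) (β := fun _ => β) (fun _ => hβ) fun _ => hf).tRed ()

theorem IsLift.tRed_root {β : ℕ} (hβ : β ∈ 𝒯.I) {f g : ℕ → ℕ} (hf : 𝒯.IsLift β g f) :
    TRed g (join (zeroJump β) f) :=
  (uReal_root (ι := Unit) (β := fun _ => β) (fun _ => hβ) fun _ => hf).tRed ()

theorem IsSubgeneric.jumpClause (h𝒯 : 𝒯.IsSubgeneric) {β : ℕ} (hβ : β ∈ 𝒯.I) {g : ℕ → ℕ}
    (hg : g ∈ 𝒯.rootPaths) : JumpClause g β := by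
  obtain ⟨c, hc⟩ := h𝒯.exists_functional_jumpIter
  have hO := 𝒯.path.subset β hβ
  refine ⟨?_, TRed.join ?_ (tRed_jumpIter_self hO)⟩
  · have h1 : UReal (fun _ : Unit => join (zeroJump β) g) (fun _ => ()) fun _ => jumpIter g β :=
      (UPartrec.functional (c := fun _ : Unit × ℕ => c) (n := fun q => q.2) (UComputable.const c)
        UComputable.snd).of_eq fun q => hc β hβ g hg _
    exact h1.tRed ()
  · exact (UReal.zeroJump_of_jumpIter (ι := Unit) (a := fun _ => ()) (X := fun _ => g)
      (β := fun _ => β) fun _ => hO).tRed ()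

theorem IsSubgeneric.meetClause (h𝒯 : 𝒯.IsSubgeneric) {β' β : ℕ} (hβ : β ∈ 𝒯.nonMax)
    (h : OLt β' β) {g : ℕ → ℕ} (hg : g ∈ 𝒯.rootPaths) : MeetClause g β' β := by
  have hβ' := mem_of_oLe hβ.1 h.oLe
  have hjump := h𝒯.jumpClause hβ' hg
  refine ⟨(tRed_join_left _ _).trans hjump.2, tRed_zeroJump_of_oLe h.oLe, fun X hXg hX0 => ?_⟩
  obtain ⟨f, hf⟩ := exists_isLift hβ.1 hg
  obtain ⟨f', hf', hff'⟩ := exists_sendsPath hβ.1 h.oLe hf.1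
  have hlift := hf.of_sendsPath hβ.1 h.oLe hf' hff'
  obtain ⟨c, hc⟩ := ((hXg.trans hjump.1).trans
    (TRed.join (tRed_join_left _ _) (hlift.tRed_root hβ'))).exists_functional
  by_contra hn
  have hs := not_not.1 (mt (tRed_of_not_splittingOver hβ' hf' hc) hn)
  exact h𝒯.not_tRed_of_splittingOver hβ h hf.1 hff' hc
    (h𝒯.splittingOver_image hf' hs hβ h.oLe) hX0

theorem IsSubgeneric.not_tRed_zeroJump (h𝒯 : 𝒯.IsSubgeneric) {β : ℕ} (hβ : β ∈ 𝒯.nonMax)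
    {g : ℕ → ℕ} (hg : g ∈ 𝒯.rootPaths) : ¬ TRed g (zeroJump β) := by
  intro h
  obtain ⟨f, hf⟩ := exists_isLift hβ.1 hg
  exact h𝒯.nontrivial β hβ f hf.1 ((hf.tRed_join hβ.1).trans
    (TRed.join (TuringReducible.refl _) h))

theorem IsSubgeneric.not_tRed_jumpIter (h𝒯 : 𝒯.IsSubgeneric) {β : ℕ} (hβ : β ∈ 𝒯.nonMax)
    {f g : ℕ → ℕ} (hf : f ∈ 𝒯.rootPaths) (hg : g ∈ 𝒯.rootPaths) (hne : f ≠ g) :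
    ¬ TRed f (jumpIter g β) := by
  intro h
  obtain ⟨f', hf'⟩ := exists_isLift hβ.1 hf
  obtain ⟨g', hg'⟩ := exists_isLift hβ.1 hg
  refine h𝒯.incomparable β hβ f' hf'.1 g' hg'.1 (fun he => hne ?_) ?_
  · exact hf'.root_unique hβ.1 (he ▸ hg')
  · have h1 : TRed f (join (zeroJump β) g') := (h.trans (h𝒯.jumpClause hβ.1 hg).1).trans
      (TRed.join (tRed_join_left _ _) (hg'.tRed_root hβ.1))
    exact (hf'.tRed_join hβ.1).trans (TRed.join (tRed_join_left _ _) h1)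

/-- One functional witnesses uniform subgenericity at all levels of the tower. -/
theorem IsSubgeneric.exists_uniformlyVia (h𝒯 : 𝒯.IsSubgeneric) : ∃ c,
    (∀ κ ∈ 𝒯.nonMax, UniformlyVia Subgeneric c κ 𝒯.rootPaths) ∧
    ∀ κ ∈ 𝒯.I, UniformlyVia SubgenericOffTop c κ 𝒯.rootPaths := by
  obtain ⟨c, hc⟩ := h𝒯.exists_functional_jumpIter
  refine ⟨c, fun κ hκ => ⟨fun g hg β' β h1 h2 => ⟨?_, ?_, ?_⟩, ?_, ?_⟩,
    fun κ hκ => ⟨fun g hg β' β h1 h2 => ⟨?_, fun hne => ?_, ?_⟩, ?_, ?_⟩⟩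
  · exact h𝒯.jumpClause (mem_of_oLe hκ.1 h2) hg
  · exact h𝒯.meetClause (mem_nonMax_of_oLe hκ h2) h1 hg
  · exact h𝒯.not_tRed_zeroJump (mem_nonMax_of_oLt (mem_of_oLe hκ.1 h2) h1) hg
  · exact fun g hg β hβ => hc β (mem_of_oLe hκ.1 hβ) g hg
  · exact fun f hf g hg β hβ hne =>
      h𝒯.not_tRed_jumpIter (mem_nonMax_of_oLt hκ.1 hβ) hf hg hne
  · exact h𝒯.jumpClause (mem_of_oLe hκ h2) hg
  · exact h𝒯.meetClause (mem_nonMax_of_oLt hκ (h2.eq_or_oLt.resolve_left hne)) h1 hg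
  · exact h𝒯.not_tRed_zeroJump (mem_nonMax_of_oLt (mem_of_oLe hκ h2) h1) hg
  · exact fun g hg β hβ => hc β (mem_of_oLe hκ hβ) g hg
  · exact fun f hf g hg β hβ hne =>
      h𝒯.not_tRed_jumpIter (mem_nonMax_of_oLt hκ hβ) hf hg hne

end TreeTower

/-! ### Paths through `𝒪` -/

theorem noteHeight_lt {a b : ℕ} (h : OLt a b) : noteHeight a < noteHeight b :=
  IsWellFounded.rank_lt_of_rel h

/-- A path through `𝒪` has no largest element, since `𝒪` is closed under successors. -/
theorem IsPathThroughO.exists_oLt {I : Set ℕ} (h : IsPathThroughO I) {a : ℕ} (ha : a ∈ I) :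
    ∃ b ∈ I, OLt a b := by
  have hO : KleeneO (succNote a) := KleeneO.succ a (h.1.subset a ha)
  obtain ⟨b, hb, hheight⟩ := h.2 _ hO
  have hlt : noteHeight a < noteHeight b := hheight ▸ noteHeight_lt (oLt_succNote hO)
  rcases h.1.linear a ha b hb with rfl | h' | h'
  · exact absurd hlt (lt_irrefl _)
  · exact ⟨b, hb, h'⟩
  · exact absurd (noteHeight_lt h') hlt.not_gt

/-- Let `𝒯` be a subgeneric tower with root `T₀`. If its height exceeds `κ`, then `[T₀]` is
uniformly `κ`-subgeneric; if its height is `κ` or more, the same holds apart from the meet clause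
at the top level `κ`; and if its height is `ω₁^CK`, then `[T₀]` is uniformly
`ω₁^CK`-subgeneric, along the index path of the tower. -/
theorem mainTheorem10 (𝒯 : TreeTower) (h𝒯 : 𝒯.IsSubgeneric) :
    (∀ κ ∈ 𝒯.nonMax, UniformlySubgeneric κ 𝒯.rootPaths) ∧
    (∀ κ ∈ 𝒯.I, UniformlySubgenericOffTop κ 𝒯.rootPaths) ∧
    (IsPathThroughO 𝒯.I →
      UniformlySubgenericAlong 𝒯.I 𝒯.rootPaths ∧ UniformlyCKSubgeneric 𝒯.rootPaths) := by
  obtain ⟨c, h1, h2⟩ := h𝒯.exists_uniformlyVia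
  refine ⟨fun κ hκ => ⟨c, h1 κ hκ⟩, fun κ hκ => ⟨c, h2 κ hκ⟩, fun hI => ?_⟩
  have h3 : UniformlySubgenericAlong 𝒯.I 𝒯.rootPaths :=
    ⟨c, fun α hα => h1 α ⟨hα, hI.exists_oLt hα⟩⟩
  exact ⟨h3, 𝒯.I, hI, h3⟩
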